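/- Let $\mathbb{P}^2$ be the projective plane of linear forms in $x_0,x_1,x_2$ over $\mathbb{C}$, where a point $P=[a_0x_0+a_1x_1+a_2x_2]$ has homogeneous coordinates $(a_0,a_1,a_2)$. For $d\in\mathbb{N}$ and a finite set $A\subset\mathbb{P}^2$ of cardinality $\ell(A)$, let $\langle v_d(A)\rangle$ be the linear span of the powers $L^d$, $[L]\in A$, in the space $S^d\mathbb{C}^3$ of ternary forms of degree $d$. The set $A$ *computes* $T\in S^d\mathbb{C}^3$ if $T\in\langle v_d(A)\rangle$; a set $A$ computing $T$ is *non-redundant* if no proper subset of $A$ computes $T$. For a finite set $Z\subset\mathbb{P}^2$ the Hilbert function $h_Z:\mathbb{Z}\to\mathbb{N}$ is defined by $h_Z(j)=0$ for $j<0$ and, for $j\ge 0$, by letting $h_Z(j)$ be the rank of the map that evaluates the forms of degree $j$ at fixed homogeneous coordinates of the points of $Z$. Put $Dh_Z(j)=h_Z(j)-h_Z(j-1)$. **Proposition.** Let $d\in\mathbb{N}$, let $T\in S^d\mathbb{C}^3$, and let $A\subset\mathbb{P}^2$ be a non-redundant finite set computing $T$. Then there is no non-redundant finite set $B\subset\mathbb{P}^2$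 computing $T$ with $A\cap B=\emptyset$ and $\ell(B)\le\ell(A)$ such that, for $Z=A\cup B$ and some integers $i,j_0,e$, the following two conditions hold: 1. $Dh_Z(j)=j+1$ for all $j\in\{0,\dots,i-1\}$, and $Dh_Z(i)\le i$; 2. $Dh_Z(j_0)=Dh_Z(j_0+1)=e<i$, and $i-1<j_0\le d+1$. -/

import Mathlib

open scoped LinearAlgebra.Projectivization

namespace Waring

noncomputable section

/-- The linear form `a₀ x₀ + ⋯ + aₙ xₙ` with coefficient vector `a`. A point of `ℙⁿ`, the projective
space of linear forms, is represented by the class of its coefficient vector. -/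
def linearForm {n : ℕ} (a : Fin (n + 1) → ℂ) : MvPolynomial (Fin (n + 1)) ℂ :=
  ∑ k, MvPolynomial.C (a k) * MvPolynomial.X k

/-- The linear span `⟨v_d(A)⟩` of the image of `A` under the degree `d` Veronese map
`[L] ↦ [L ^ d]`, as a linear subspace of polynomials (the affine cone over the projective span).
Another choice of representatives only rescales the generators by nonzero constants. -/
def veroneseSpan {n : ℕ} (d : ℕ) (A : Finset (ℙ ℂ (Fin (n + 1) → ℂ))) :
    Submodule ℂ (MvPolynomial (Fin (n + 1)) ℂ) :=
  Submodule.span ℂ ((fun P : ℙ ℂ (Fin (n + 1) → ℂ) => linearForm P.rep ^ d) '' (A : Set _))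

/-- `A` computes the form `T` of degree `d`: `T ∈ ⟨v_d(A)⟩`. -/
def Computes {n : ℕ} (d : ℕ) (A : Finset (ℙ ℂ (Fin (n + 1) → ℂ)))
    (T : MvPolynomial (Fin (n + 1)) ℂ) : Prop :=
  T ∈ veroneseSpan d A

/-- `A` computes `T` and is non-redundant: no proper subset of `A` computes `T`. -/
def NonRedundant {n : ℕ} (d : ℕ) (A : Finset (ℙ ℂ (Fin (n + 1) → ℂ)))
    (T : MvPolynomial (Fin (n + 1)) ℂ) : Prop :=
  Computes d A T ∧ ∀ A' : Finset (ℙ ℂ (Fin (n + 1) → ℂ)), A' ⊂ A → ¬ Computes d A' T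

/-- The evaluation map of degree `j` at (homogeneous coordinates of) the points of `Z`. -/
def evalMap {n : ℕ} (Z : Finset (ℙ ℂ (Fin (n + 1) → ℂ))) (j : ℕ) :
    MvPolynomial.homogeneousSubmodule (Fin (n + 1)) ℂ j →ₗ[ℂ] (Z → ℂ) :=
  LinearMap.pi fun P =>
    (MvPolynomial.aeval (R := ℂ) P.1.rep).toLinearMap ∘ₗ Submodule.subtype _

/-- The Hilbert function `h_Z : ℤ → ℕ`: zero in negative degrees, and the rank of the evaluation
map in degrees `j ≥ 0`. -/
def hilbertFunction {n : ℕ} (Z : Finset (ℙ ℂ (Fin (n + 1) → ℂ))) (j : ℤ) : ℕ :=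
  if j < 0 then 0 else Module.finrank ℂ (LinearMap.range (evalMap Z j.toNat))

/-- The first difference `Dh_Z(j) = h_Z(j) - h_Z(j - 1)`, as an integer. -/
def Dh {n : ℕ} (Z : Finset (ℙ ℂ (Fin (n + 1) → ℂ))) (j : ℤ) : ℤ :=
  (hilbertFunction Z j : ℤ) - (hilbertFunction Z (j - 1) : ℤ)

end

end Waring

/-! Subtracting the expressions of `T` by the disjoint sets `A` and `B` gives a relation, with no
zero coefficient, between the values of degree `d` forms at the points of `Z = A ∪ B`: a strong
Cayley–Bacharach property. Equality of `Dh` in degrees `j₀` and `j₀ + 1` forces the curves of degree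
`j₀` through `Z` to share a component of degree at most `e`, as in Davis's theorem, and the relation
forces all of `Z` onto that component. But `Dh` is maximal in degrees up to `e < i`, so no curve of
degree at most `e` contains `Z`.

The argument is affine, with the line at infinity off `Z`. For `I` the ideal of `Z`, `Dh` in degree
`t` is the codimension of the leading forms of degree `t` of `I`. Put `n = j₀ = m + e`. The leading
forms have dimensions `m + 1` and `m + 2` in degrees `n` and `n + 1`, so those of degree `n` are the
multiples of one polynomial `f` (`exists_mul_degreeLT`). By `mem_prolong_of_mem_succ`, all leading
forms of the ideal generated by the elements of `I` of degree at most `n` are divisible by `f`. This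
persists in its saturation `H` with respect to `k[x]`, which is principal
(`exists_generator_of_saturated`); comparing leading forms, its generator has degree at most `e`.
The relation is a functional `Λ` that kills `I` and all degrees below `n ≤ d + 1`. Subtracting
elements of `I` with the same leading form shows that `Λ` kills `H`. As `H` is an ideal and `Λ` is
nondegenerate modulo `I`, `H ⊆ I`. -/

namespace Waring

open Polynomial

/-! ### Affine bivariate polynomials, leading forms and prolongations. -/

section Bivariate

variable {k : Type*} [Field k]

/-- The substitution `x ↦ w`, `y ↦ s w` from `k[x][y]` to `k[s][w]`: the coefficient of `w ^ t` is
the homogeneous component of degree `t`, dehomogenized with respect to `x`. -/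
noncomputable def radial : k[X][X] →ₐ[k] k[X][X] :=
  aevalAeval X (C X * X)

@[simp] lemma radial_X : radial (X : k[X][X]) = C X * X := by
  simp [radial]

@[simp] lemma radial_C_X : radial (C X : k[X][X]) = X := by
  simp [radial]

lemma radial_C (p : k[X]) : radial (C p) = p.map C := by
  induction p using Polynomial.induction_on' with
  | add p q hp hq => simp [hp, hq]
  | monomial n a =>
    have : (C (monomial n a) : k[X][X]) = a • C X ^ n := by
      rw [← C_pow, ← C_mul_X_pow_eq_monomial, smul_C, smul_eq_C_mul]
    rw [this, map_smul, map_pow, radial_C_X, map_monomial, ← C_mul_X_pow_eq_monomial,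
      Algebra.smul_def]
    rfl

/-- The monomial `x ^ a * y ^ b` goes to `s ^ b * w ^ (a + b)`, so no coefficient is lost or merged.
-/
lemma coeff_coeff_radial (u : k[X][X]) (t b : ℕ) :
    ((radial u).coeff t).coeff b = if b ≤ t then (u.coeff b).coeff (t - b) else 0 := by
  induction u using Polynomial.induction_on' with
  | add p q hp hq => simp only [map_add, coeff_add, hp, hq]; split_ifs <;> simp
  | monomial n p =>
    induction p using Polynomial.induction_on' with
    | add p q hp hq =>
      simp only [map_add, coeff_add, hp, hq]; split_ifs <;> simp
    | monomial m a =>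
      have : radial (monomial n (monomial m a)) = C (C a * X ^ n) * X ^ (m + n) := by
        rw [← C_mul_X_pow_eq_monomial, map_mul, map_pow, radial_X, radial_C, map_monomial,
          ← C_mul_X_pow_eq_monomial]
        simp only [map_mul, map_pow, mul_pow, pow_add]; ring
      rw [this, coeff_C_mul_X_pow, coeff_monomial]
      by_cases h1 : t = m + n
      · subst h1
        rw [if_pos rfl, coeff_C_mul_X_pow]
        by_cases h2 : b = n
        · simp [h2]
        · simp [h2, Ne.symm h2]
      · rw [if_neg h1, coeff_zero]
        by_cases h2 : n = b
        · by_cases h3 : b ≤ t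
          · rw [if_pos h3, if_pos h2, coeff_monomial, if_neg (by omega)]
          · rw [if_neg h3]
        · simp [h2]

lemma radial_injective : Function.Injective (radial : k[X][X] → k[X][X]) := by
  rw [injective_iff_map_eq_zero]
  intro u hu
  ext b a
  have := coeff_coeff_radial u (a + b) b
  simp only [hu, coeff_zero, le_add_iff_nonneg_left, zero_le, if_true,
    Nat.add_sub_cancel] at this
  simp [← this]

/-- Bivariate polynomials of total degree at most `t`. -/
noncomputable def totalDegreeLE (k : Type*) [Field k] (t : ℕ) : Submodule k k[X][X] where
  carrier := {u | (radial u).natDegree ≤ t}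
  add_mem' {a b} ha hb := by
    simp only [Set.mem_ofPred_eq, map_add] at *
    exact natDegree_add_le_of_degree_le ha hb
  zero_mem' := by simp
  smul_mem' c x hx := by
    simp only [Set.mem_ofPred_eq, map_smul] at *
    exact (natDegree_smul_le _ _).trans hx

lemma mem_totalDegreeLE {t : ℕ} {u : k[X][X]} :
    u ∈ totalDegreeLE k t ↔ (radial u).natDegree ≤ t := Iff.rfl

lemma totalDegreeLE_mono {s t : ℕ} (h : s ≤ t) : totalDegreeLE k s ≤ totalDegreeLE k t :=
  fun _ hu => le_trans (mem_totalDegreeLE.1 hu) h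

/-- The homogeneous component of degree `t`, dehomogenized. -/
noncomputable def topCoeff (t : ℕ) : k[X][X] →ₗ[k] k[X] :=
  ((lcoeff k[X] t).restrictScalars k) ∘ₗ radial.toLinearMap

lemma topCoeff_apply (t : ℕ) (u : k[X][X]) : topCoeff t u = (radial u).coeff t := rfl

lemma topCoeff_succ_C_X_mul (t : ℕ) (u : k[X][X]) :
    topCoeff (t + 1) (C X * u) = topCoeff t u := by
  simp [topCoeff_apply]

lemma topCoeff_C_X_pow_mul (t j : ℕ) (u : k[X][X]) :
    topCoeff (t + j) (C X ^ j * u) = topCoeff t u := by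
  simp [topCoeff_apply]

lemma topCoeff_succ_X_mul (t : ℕ) (u : k[X][X]) :
    topCoeff (t + 1) (X * u) = X * topCoeff t u := by
  simp [topCoeff_apply, mul_assoc]

lemma natDegree_topCoeff_le (t : ℕ) (u : k[X][X]) : (topCoeff t u).natDegree ≤ t := by
  rw [natDegree_le_iff_coeff_eq_zero]
  intro b hb
  rw [topCoeff_apply, coeff_coeff_radial, if_neg (by omega)]

lemma topCoeff_eq_zero {s t : ℕ} {u : k[X][X]} (hu : u ∈ totalDegreeLE k s) (h : s < t) :
    topCoeff t u = 0 :=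
  coeff_eq_zero_of_natDegree_lt (lt_of_le_of_lt hu h)

lemma mem_totalDegreeLE_of_topCoeff_eq_zero {t : ℕ} {u : k[X][X]}
    (hu : u ∈ totalDegreeLE k (t + 1)) (h : topCoeff (t + 1) u = 0) : u ∈ totalDegreeLE k t := by
  rw [mem_totalDegreeLE] at *
  by_contra! hlt
  have h2 : (radial u).natDegree = t + 1 := by omega
  have : (radial u).leadingCoeff = 0 := by rw [leadingCoeff, h2]; exact h
  rw [leadingCoeff_eq_zero] at this
  simp [this] at hlt

lemma C_X_mul_mem {t : ℕ} {u : k[X][X]} (hu : u ∈ totalDegreeLE k t) :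
    C X * u ∈ totalDegreeLE k (t + 1) := by
  rw [mem_totalDegreeLE] at *
  rw [map_mul, radial_C_X]
  refine natDegree_mul_le.trans ?_
  rw [natDegree_X]; omega

lemma X_mul_mem {t : ℕ} {u : k[X][X]} (hu : u ∈ totalDegreeLE k t) :
    X * u ∈ totalDegreeLE k (t + 1) := by
  rw [mem_totalDegreeLE] at *
  rw [map_mul, radial_X]
  refine natDegree_mul_le.trans ?_
  have : (C X * X : k[X][X]).natDegree ≤ 1 := (natDegree_C_mul_le _ _).trans natDegree_X_le
  omega

lemma C_X_pow_mul_mem {t : ℕ} (j : ℕ) {u : k[X][X]} (hu : u ∈ totalDegreeLE k t) :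
    C X ^ j * u ∈ totalDegreeLE k (t + j) := by
  induction j with
  | zero => simpa using hu
  | succ j ih => rw [pow_succ', mul_assoc]; exact C_X_mul_mem ih

/-- The leading forms, in degree `t`, of the elements of degree at most `t` of an ideal. -/
noncomputable def leadingForms (I : Ideal k[X][X]) (t : ℕ) : Submodule k k[X] :=
  (I.restrictScalars k ⊓ totalDegreeLE k t).map (topCoeff t)

lemma leadingForms_le (I : Ideal k[X][X]) (t : ℕ) : leadingForms I t ≤ degreeLT k (t + 1) := by
  rintro _ ⟨u, -, rfl⟩
  rw [mem_degreeLT]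
  exact degree_le_natDegree.trans_lt
    (by exact_mod_cast Nat.lt_succ_of_le (natDegree_topCoeff_le t u))

lemma mem_leadingForms {I : Ideal k[X][X]} {t : ℕ} {p : k[X]} :
    p ∈ leadingForms I t ↔ ∃ u ∈ I, u ∈ totalDegreeLE k t ∧ topCoeff t u = p := by
  simp [leadingForms, and_assoc]

instance finite_degreeLT (n : ℕ) : FiniteDimensional k (degreeLT k n) :=
  (degreeLTEquiv k n).symm.finiteDimensional

instance (I : Ideal k[X][X]) (t : ℕ) : FiniteDimensional k (leadingForms I t) :=
  Submodule.finiteDimensional_of_le (leadingForms_le I t)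

lemma exists_submodule_le_finrank_eq {M : Type*} [AddCommGroup M] [Module k M]
    (U : Submodule k M) [FiniteDimensional k U] {n : ℕ} (h : n ≤ Module.finrank k U) :
    ∃ U' ≤ U, Module.finrank k U' = n := by
  have b := Module.finBasis k U
  let v : Fin n → M := fun i => (b (Fin.castLE h i) : M)
  have hv : LinearIndependent k v :=
    (b.linearIndependent.map' U.subtype (by simp)).comp _ (Fin.castLE_injective h)
  refine ⟨Submodule.span k (Set.range v), ?_, ?_⟩
  · rw [Submodule.span_le]
    rintro _ ⟨i, rfl⟩
    exact (b _).2
  · rw [finrank_span_eq_card hv, Fintype.card_fin]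

/-- A space `W` of polynomials such that `W + sW` is just one dimension larger consists of all
multiples, up to some degree, of one polynomial. -/
lemma exists_mul_degreeLT (m : ℕ) (W W' : Submodule k k[X]) [FiniteDimensional k W]
    [FiniteDimensional k W'] (hW : Module.finrank k W = m + 1)
    (hW' : Module.finrank k W' ≤ m + 2) (hle : W ≤ W') (hX : ∀ p ∈ W, X * p ∈ W') :
    ∃ f ≠ 0, W = (degreeLT k (m + 1)).map (LinearMap.mulLeft k f) := by
  induction m generalizing W W' with
  | zero =>
    obtain ⟨f, hf, hfs⟩ := finrank_eq_one_iff'.1 (by simpa using hW)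
    refine ⟨f, by simpa using hf, ?_⟩
    ext p
    constructor
    · intro hp
      obtain ⟨c, hc⟩ := hfs ⟨p, hp⟩
      refine ⟨C c, ?_, ?_⟩
      · rw [SetLike.mem_coe, mem_degreeLT]; exact degree_C_le.trans_lt (by simp)
      · have := congrArg Subtype.val hc
        simp only [Submodule.coe_smul] at this
        simp [← this, smul_eq_C_mul, mul_comm]
    · rintro ⟨q, hq, rfl⟩
      rw [SetLike.mem_coe, mem_degreeLT] at hq
      have : q = C (q.coeff 0) := eq_C_of_degree_le_zero
        (by rw [degree_le_iff_coeff_zero]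
            rw [degree_lt_iff_coeff_zero] at hq
            exact fun j hj => hq j (by exact_mod_cast hj))
      rw [this, LinearMap.mulLeft_apply, mul_comm, ← smul_eq_C_mul]
      exact W.smul_mem _ f.2
  | succ m ih =>
    let W₁ : Submodule k W' := W.comap W'.subtype
    have hW₁ : Module.finrank k W₁ = m + 2 := by
      rw [← hW]
      exact LinearEquiv.finrank_eq (Submodule.comapSubtypeEquivOfLe hle)
    -- The kernel is `{p ∈ W | X * p ∈ W}`. The target has dimension at most one, so the kernel has
    -- codimension at most one.
    let φ : W →ₗ[k] (W' ⧸ W₁) := W₁.mkQ ∘ₗ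
      (LinearMap.codRestrict W' (LinearMap.mulLeft k X ∘ₗ W.subtype) (fun p => hX p p.2))
    have h1 := LinearMap.finrank_range_add_finrank_ker φ
    have h2 := Submodule.finrank_quotient_add_finrank W₁
    have h3 := Submodule.finrank_le (LinearMap.range φ)
    have h4 : m + 1 ≤ Module.finrank k (LinearMap.ker φ) := by omega
    let U := (LinearMap.ker φ).map W.subtype
    have hU : ∀ p ∈ U, p ∈ W ∧ X * p ∈ W := by
      rintro _ ⟨p, hp, rfl⟩
      refine ⟨p.2, ?_⟩
      have : φ p = 0 := hp
      simp only [φ, W₁, LinearMap.comp_apply, Submodule.mkQ_apply,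
        Submodule.Quotient.mk_eq_zero, Submodule.mem_comap] at this
      exact this
    have h5 : m + 1 ≤ Module.finrank k U := by
      rw [(Submodule.equivMapOfInjective W.subtype W.injective_subtype _).finrank_eq.symm]
      exact h4
    -- A subspace of dimension exactly `m + 1` allows induction, with `W` now in the role of `W'`.
    obtain ⟨U', hU'U, hU'⟩ := exists_submodule_le_finrank_eq U h5
    have : FiniteDimensional k U' :=
      Submodule.finiteDimensional_of_le (hU'U.trans fun p hp => (hU p hp).1)
    obtain ⟨f, hf, hU'f⟩ := ih U' W hU' (by omega) (fun p hp => (hU p (hU'U hp)).1)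
      (fun p hp => (hU p (hU'U hp)).2)
    refine ⟨f, hf, (Submodule.eq_of_le_of_finrank_eq ?_ ?_).symm⟩
    · rintro _ ⟨q, hq, rfl⟩
      rw [SetLike.mem_coe, mem_degreeLT] at hq
      have key : ∀ r : k[X], r.degree < ((m + 1 : ℕ) : WithBot ℕ) → f * r ∈ U' := by
        intro r hr
        rw [hU'f]
        exact ⟨r, mem_degreeLT.2 hr, rfl⟩
      rw [LinearMap.mulLeft_apply, ← divX_mul_X_add q, mul_add]
      refine W.add_mem ?_ ?_
      · rw [mul_comm q.divX, ← mul_assoc, mul_comm f, mul_assoc]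
        refine (hU _ (hU'U (key _ ?_))).2
        rw [degree_lt_iff_coeff_zero] at hq ⊢
        intro j hj
        rw [coeff_divX]
        exact hq _ (by omega)
      · exact (hU _ (hU'U (key _ (degree_C_le.trans_lt (by norm_cast; omega))))).1
    · rw [hW, ← (Submodule.equivMapOfInjective _
        (mul_right_injective₀ hf : Function.Injective (LinearMap.mulLeft k f)) _).finrank_eq,
        (degreeLTEquiv k _).finrank_eq]
      simp

/-- The elements of `V · k[x, y]_{≤ r}`. -/
noncomputable def prolong (V : Submodule k k[X][X]) : ℕ → Submodule k k[X][X]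
  | 0 => V
  | r + 1 => prolong V r ⊔ (prolong V r).map (LinearMap.mulLeft k (C X)) ⊔
      (prolong V r).map (LinearMap.mulLeft k X)

lemma mem_prolong_succ {V : Submodule k k[X][X]} {r : ℕ} {u : k[X][X]} :
    u ∈ prolong V (r + 1) ↔ ∃ a ∈ prolong V r, ∃ b ∈ prolong V r, ∃ c ∈ prolong V r,
      u = a + C X * b + X * c := by
  simp only [prolong, Submodule.mem_sup, Submodule.mem_map, LinearMap.mulLeft_apply]
  constructor
  · rintro ⟨_, ⟨a, ha, _, ⟨b, hb, rfl⟩, rfl⟩, _, ⟨c, hc, rfl⟩, rfl⟩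
    exact ⟨a, ha, b, hb, c, hc, rfl⟩
  · rintro ⟨a, ha, b, hb, c, hc, rfl⟩
    exact ⟨_, ⟨a, ha, _, ⟨b, hb, rfl⟩, rfl⟩, _, ⟨c, hc, rfl⟩, rfl⟩

lemma prolong_mono (V : Submodule k k[X][X]) : Monotone (prolong V) :=
  monotone_nat_of_le_succ fun _ u hu =>
    mem_prolong_succ.2 ⟨u, hu, 0, zero_mem _, 0, zero_mem _, by simp⟩

lemma C_X_mul_mem_prolong {V : Submodule k k[X][X]} {r : ℕ} {u : k[X][X]}
    (hu : u ∈ prolong V r) : C X * u ∈ prolong V (r + 1) :=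
  mem_prolong_succ.2 ⟨0, zero_mem _, u, hu, 0, zero_mem _, by simp⟩

lemma X_mul_mem_prolong {V : Submodule k k[X][X]} {r : ℕ} {u : k[X][X]}
    (hu : u ∈ prolong V r) : X * u ∈ prolong V (r + 1) :=
  mem_prolong_succ.2 ⟨0, zero_mem _, 0, zero_mem _, u, hu, by simp⟩

/-- The ideal generated by a subspace, as the union of its prolongations. -/
noncomputable def prolongIdeal (V : Submodule k k[X][X]) : Ideal k[X][X] where
  carrier := {u | ∃ r, u ∈ prolong V r}
  add_mem' := by
    rintro a b ⟨r, hr⟩ ⟨s, hs⟩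
    exact ⟨max r s, add_mem (prolong_mono V (le_max_left _ _) hr)
      (prolong_mono V (le_max_right _ _) hs)⟩
  zero_mem' := ⟨0, zero_mem _⟩
  smul_mem' := by
    rintro g u ⟨r, hr⟩
    simp only [Set.mem_ofPred_eq, smul_eq_mul]
    have hadd : ∀ p q : k[X][X], (∃ r, p * u ∈ prolong V r) → (∃ r, q * u ∈ prolong V r) →
        ∃ r, (p + q) * u ∈ prolong V r := by
      rintro p q ⟨r, hr⟩ ⟨s, hs⟩
      rw [add_mul]
      exact ⟨max r s, add_mem (prolong_mono V (le_max_left _ _) hr)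
        (prolong_mono V (le_max_right _ _) hs)⟩
    induction g using Polynomial.induction_on' with
    | add p q hp hq => exact hadd p q hp hq
    | monomial n p =>
      induction p using Polynomial.induction_on' with
      | add p q hp hq => rw [map_add]; exact hadd _ _ hp hq
      | monomial m a =>
        have e : monomial n (monomial m a) * u = a • (X ^ n * (C X ^ m * u)) := by
          rw [← C_mul_X_pow_eq_monomial, ← C_mul_X_pow_eq_monomial, map_mul]
          have : ∀ v : k[X][X], a • v = C (C a) * v := fun v => by
            rw [Algebra.smul_def]; rfl
          rw [this, map_pow]
          ring
        rw [e]
        have h1 : ∀ m, C X ^ m * u ∈ prolong V (r + m) := by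
          intro m
          induction m with
          | zero => simpa using hr
          | succ m ih => rw [pow_succ', mul_assoc]; exact C_X_mul_mem_prolong ih
        have h2 : ∀ n, X ^ n * (C X ^ m * u) ∈ prolong V (r + m + n) := by
          intro n
          induction n with
          | zero => simpa using h1 m
          | succ n ih => rw [pow_succ', mul_assoc]; exact X_mul_mem_prolong ih
        exact ⟨_, Submodule.smul_mem _ _ (h2 n)⟩

lemma mem_prolongIdeal {V : Submodule k k[X][X]} {u : k[X][X]} :
    u ∈ prolongIdeal V ↔ ∃ r, u ∈ prolong V r := Iff.rfl

end Bivariate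

/-! ### Persistence of the common factor and the curve it produces. -/

section Core

variable {k : Type*} [Field k] {I : Ideal k[X][X]} {n m : ℕ} {f : k[X]}

lemma prolong_le (r : ℕ) {u : k[X][X]}
    (hu : u ∈ prolong (I.restrictScalars k ⊓ totalDegreeLE k n) r) :
    u ∈ I ∧ u ∈ totalDegreeLE k (n + r) := by
  induction r generalizing u with
  | zero => exact hu
  | succ r ih =>
    obtain ⟨a, ha, b, hb, c, hc, rfl⟩ := mem_prolong_succ.1 hu
    exact ⟨I.add_mem (I.add_mem (ih ha).1 (I.mul_mem_left _ (ih hb).1))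
      (I.mul_mem_left _ (ih hc).1),
      add_mem (add_mem (totalDegreeLE_mono (Nat.le_succ _) (ih ha).2) (C_X_mul_mem (ih hb).2))
        (X_mul_mem (ih hc).2)⟩

lemma topCoeff_of_mem_prolong
    (hV : leadingForms I n = (degreeLT k (m + 1)).map (LinearMap.mulLeft k f)) (r : ℕ)
    {u : k[X][X]} (hu : u ∈ prolong (I.restrictScalars k ⊓ totalDegreeLE k n) r) :
    ∃ q : k[X], q ∈ degreeLT k (m + r + 1) ∧ topCoeff (n + r) u = f * q := by
  induction r generalizing u with
  | zero =>
    have : topCoeff n u ∈ leadingForms I n := ⟨u, hu, rfl⟩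
    rw [hV] at this
    obtain ⟨q, hq, h⟩ := this
    exact ⟨q, hq, h.symm⟩
  | succ r ih =>
    obtain ⟨a, ha, b, hb, c, hc, rfl⟩ := mem_prolong_succ.1 hu
    obtain ⟨p, hp, hpe⟩ := ih hb
    obtain ⟨q, hq, hqe⟩ := ih hc
    refine ⟨p + X * q, ?_, ?_⟩
    · refine add_mem (degreeLT_mono (by omega) hp) ?_
      rw [mem_degreeLT, degree_lt_iff_coeff_zero] at hq ⊢
      rintro (_ | j) hj
      · simp
      · rw [coeff_X_mul]; exact hq j (by omega)
    · rw [← add_assoc, map_add, map_add, topCoeff_succ_C_X_mul, topCoeff_succ_X_mul, hpe, hqe,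
        topCoeff_eq_zero (prolong_le r ha).2 (Nat.lt_succ_self _)]
      ring

/-- Split `q` as its constant term plus `X * q.divX`: the first part is reached by multiplying by
`x`, the second by `y`. -/
lemma exists_mem_prolong_topCoeff_eq
    (hV : leadingForms I n = (degreeLT k (m + 1)).map (LinearMap.mulLeft k f)) (r : ℕ)
    {q : k[X]} (hq : q ∈ degreeLT k (m + r + 1)) :
    ∃ u ∈ prolong (I.restrictScalars k ⊓ totalDegreeLE k n) r, topCoeff (n + r) u = f * q := by
  induction r generalizing q with
  | zero =>
    have : f * q ∈ leadingForms I n := by rw [hV]; exact ⟨q, hq, rfl⟩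
    obtain ⟨u, hu, h⟩ := this
    exact ⟨u, hu, h⟩
  | succ r ih =>
    have h0 : C (q.coeff 0) ∈ degreeLT k (m + r + 1) := by
      rw [mem_degreeLT]; exact degree_C_le.trans_lt (by norm_cast; omega)
    have h1 : q.divX ∈ degreeLT k (m + r + 1) := by
      rw [mem_degreeLT, degree_lt_iff_coeff_zero] at hq ⊢
      intro j hj
      rw [coeff_divX]; exact hq _ (by omega)
    obtain ⟨b, hb, hbe⟩ := ih h0
    obtain ⟨c, hc, hce⟩ := ih h1
    refine ⟨0 + C X * b + X * c, mem_prolong_succ.2 ⟨0, zero_mem _, b, hb, c, hc, rfl⟩, ?_⟩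
    rw [zero_add, ← add_assoc, map_add, topCoeff_succ_C_X_mul, topCoeff_succ_X_mul, hbe, hce]
    conv_rhs => rw [← divX_mul_X_add q]
    ring

/-- Prolongation creates no new elements of low degree. -/
lemma mem_prolong_of_mem_succ
    (hV : leadingForms I n = (degreeLT k (m + 1)).map (LinearMap.mulLeft k f)) (hf : f ≠ 0)
    (r : ℕ) {u : k[X][X]}
    (hu : u ∈ prolong (I.restrictScalars k ⊓ totalDegreeLE k n) (r + 1))
    (hd : u ∈ totalDegreeLE k (n + r)) :
    u ∈ prolong (I.restrictScalars k ⊓ totalDegreeLE k n) r := by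
  induction r generalizing u with
  | zero => exact ⟨(prolong_le _ hu).1, hd⟩
  | succ r ih =>
    obtain ⟨a, ha, b, hb, c, hc, rfl⟩ := mem_prolong_succ.1 hu
    obtain ⟨p, hp, hpe⟩ := topCoeff_of_mem_prolong hV _ hb
    obtain ⟨q, hq, hqe⟩ := topCoeff_of_mem_prolong hV _ hc
    have htop := topCoeff_eq_zero hd (Nat.lt_succ_self (n + (r + 1)))
    rw [Nat.succ_eq_add_one, map_add, map_add, topCoeff_succ_C_X_mul, topCoeff_succ_X_mul, hpe,
      hqe, topCoeff_eq_zero (prolong_le _ ha).2 (Nat.lt_succ_self _), zero_add] at htop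
    -- The leading parts of `x b` and `y c` can cancel only through the Koszul syzygy of `x` and
    -- `y`.
    have hpq : p = -(X * q) := by
      have : f * (p + X * q) = 0 := by rw [← htop]; ring
      rcases mul_eq_zero.1 this with h | h
      · exact absurd h hf
      · exact eq_neg_of_add_eq_zero_left h
    have hq' : q ∈ degreeLT k (m + r + 1) := by
      rw [mem_degreeLT, degree_lt_iff_coeff_zero] at hp ⊢
      intro j hj
      have := hp (j + 1) (by omega)
      rwa [hpq, coeff_neg, coeff_X_mul, neg_eq_zero] at this
    -- Subtracting that syzygy, `x b + y c = x (b + y g) + y (c - x g)`; both new cofactors drop in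
    -- degree, so the induction hypothesis applies to them.
    obtain ⟨g, hg, hge⟩ := exists_mem_prolong_topCoeff_eq hV r hq'
    have hb' : b + X * g ∈ prolong (I.restrictScalars k ⊓ totalDegreeLE k n) r := by
      refine ih (add_mem hb (X_mul_mem_prolong hg)) ?_
      refine mem_totalDegreeLE_of_topCoeff_eq_zero
        (add_mem (prolong_le _ hb).2 (X_mul_mem (prolong_le _ hg).2)) ?_
      rw [map_add, topCoeff_succ_X_mul, hge]
      rw [← add_assoc] at hpe
      rw [hpe, hpq]; ring
    have hc' : c - C X * g ∈ prolong (I.restrictScalars k ⊓ totalDegreeLE k n) r := by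
      refine ih (sub_mem hc (C_X_mul_mem_prolong hg)) ?_
      refine mem_totalDegreeLE_of_topCoeff_eq_zero
        (sub_mem (prolong_le _ hc).2 (C_X_mul_mem (prolong_le _ hg).2)) ?_
      rw [map_sub, topCoeff_succ_C_X_mul, hge]
      rw [← add_assoc] at hqe
      rw [hqe]; ring
    have e : a + C X * b + X * c = a + C X * (b + X * g) + X * (c - C X * g) := by ring
    rw [e]
    exact add_mem (add_mem ha (C_X_mul_mem_prolong hb')) (X_mul_mem_prolong hc')

lemma dvd_leadingCoeff_of_mem_prolong
    (hV : leadingForms I n = (degreeLT k (m + 1)).map (LinearMap.mulLeft k f)) (hf : f ≠ 0)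
    (r : ℕ) {u : k[X][X]}
    (hu : u ∈ prolong (I.restrictScalars k ⊓ totalDegreeLE k n) r) :
    f ∣ (radial u).leadingCoeff := by
  induction r with
  | zero =>
    -- Multiplying by a power of `x` raises the degree to `n` without changing the dehomogenized
    -- leading form.
    obtain ⟨j, hj⟩ := Nat.exists_eq_add_of_le (mem_totalDegreeLE.1 hu.2)
    have hmem : C X ^ j * u ∈ I.restrictScalars k ⊓ totalDegreeLE k n :=
      ⟨I.mul_mem_left _ hu.1, hj ▸ C_X_pow_mul_mem j (mem_totalDegreeLE.2 le_rfl)⟩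
    obtain ⟨q, -, hq⟩ := topCoeff_of_mem_prolong hV 0 hmem
    rw [add_zero, hj, topCoeff_C_X_pow_mul] at hq
    exact ⟨q, hq⟩
  | succ r ih =>
    by_cases hd : u ∈ totalDegreeLE k (n + r)
    · exact ih (mem_prolong_of_mem_succ hV hf r hu hd)
    · have h1 := mem_totalDegreeLE.1 (prolong_le _ hu).2
      rw [mem_totalDegreeLE] at hd
      obtain ⟨q, -, hq⟩ := topCoeff_of_mem_prolong hV _ hu
      have : (radial u).natDegree = n + (r + 1) := by omega
      exact ⟨q, by rw [leadingCoeff, this]; exact hq⟩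

/-- A nonzero ideal of `k[x][y]` that is saturated with respect to `k[x]` is principal. -/
lemma exists_generator_of_saturated (H : Ideal k[X][X]) (hH : H ≠ ⊥)
    (hsat : ∀ (p : k[X]) (u : k[X][X]), p ≠ 0 → C p * u ∈ H → u ∈ H) :
    ∃ F ∈ H, F ≠ 0 ∧ ∀ u ∈ H, F ∣ u := by
  classical
  obtain ⟨u₀, hu₀, hu₀0⟩ := Submodule.exists_mem_ne_zero_of_ne_bot hH
  have hex : ∃ j, ∃ u ∈ H, u ≠ 0 ∧ u.natDegree = j := ⟨_, u₀, hu₀, hu₀0, rfl⟩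
  obtain ⟨F₀, hF₀, hF₀0, hdeg⟩ := Nat.find_spec hex
  have hmin : ∀ u ∈ H, u ≠ 0 → F₀.natDegree ≤ u.natDegree := fun u hu hu0 => by
    rw [hdeg]; exact Nat.find_min' hex ⟨u, hu, hu0, rfl⟩
  obtain ⟨inst⟩ : Nonempty (NormalizedGCDMonoid k[X]) := inferInstance
  set F := F₀.primPart with hF
  have hFd : F.natDegree = F₀.natDegree := natDegree_primPart _
  have hFprim : F.IsPrimitive := isPrimitive_primPart _
  have hF0 : F ≠ 0 := hFprim.ne_zero
  -- Saturation allows the content of an element of least `y`-degree to be removed.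
  have hFH : F ∈ H := hsat F₀.content _ (by rwa [Ne, content_eq_zero_iff])
    (by rw [hF, ← eq_C_content_mul_primPart]; exact hF₀)
  have key : ∀ j : ℕ, ∀ u ∈ H, u.degree < j → F ∣ u := by
    intro j
    induction j with
    | zero =>
      intro u _ hu
      have : u = 0 := by simpa using hu
      exact this ▸ dvd_zero _
    | succ j ih =>
      intro u huH hu
      rcases eq_or_ne u 0 with rfl | hu0
      · exact dvd_zero _
      have hle : F.natDegree ≤ u.natDegree := hFd ▸ hmin u huH hu0
      -- Pseudo-division by `F`; Gauss's lemma for the primitive `F` then removes the factor `C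
      -- F.leadingCoeff`.
      set v := C F.leadingCoeff * u - C u.leadingCoeff * X ^ (u.natDegree - F.natDegree) * F
        with hv
      have hFl : C F.leadingCoeff ≠ 0 := by simpa using hF0
      have hul : C u.leadingCoeff ≠ 0 := by simpa using hu0
      have hvdeg : v.degree < (C F.leadingCoeff * u).degree := by
        refine degree_sub_lt_left ?_ (mul_ne_zero hFl hu0) ?_
        · rw [degree_mul, degree_mul, degree_mul, degree_C (by simpa using hF0),
            degree_C (by simpa using hu0), degree_X_pow, degree_eq_natDegree hu0,
            degree_eq_natDegree hF0]
          norm_cast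
          omega
        · simp only [leadingCoeff_mul, leadingCoeff_C, leadingCoeff_X_pow]; ring
      rw [degree_mul, degree_C (by simpa using hF0), zero_add] at hvdeg
      have hvj : v.degree < j := by
        rw [degree_eq_natDegree hu0] at hu hvdeg
        refine lt_of_lt_of_le hvdeg ?_
        norm_cast at hu ⊢
        omega
      have h1 : F ∣ v := ih v (H.sub_mem (H.mul_mem_left _ huH) (H.mul_mem_left _ hFH)) hvj
      have h2 : F ∣ C F.leadingCoeff * u := by
        rw [hv] at h1
        exact (dvd_sub_left (dvd_mul_left F _)).1 h1
      refine hFprim.dvd_of_fraction_map_dvd_fraction_map (K := FractionRing k[X]) ?_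
      have h3 := Polynomial.map_dvd (algebraMap k[X] (FractionRing k[X])) h2
      rw [Polynomial.map_mul, map_C] at h3
      refine (IsUnit.dvd_mul_left ?_).1 h3
      rw [isUnit_C, isUnit_iff_ne_zero]
      simpa using hF0
  refine ⟨F, hFH, hF0, fun u hu => key (u.natDegree + 1) u hu ?_⟩
  exact degree_le_natDegree.trans_lt (by norm_cast; omega)

/-- The leading form of `p(x)` is a power of `x`, which dehomogenizes to a scalar; so saturating by
`k[x]` preserves divisibility of leading forms by `f`. -/
lemma leadingCoeff_radial_C_mul (p : k[X]) (u : k[X][X]) :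
    (radial (C p * u)).leadingCoeff = C p.leadingCoeff * (radial u).leadingCoeff := by
  rw [map_mul, radial_C, leadingCoeff_mul, leadingCoeff_map_of_injective C_injective]

/-- If the leading forms of an ideal `I` have the same codimension `e` in two consecutive degrees
`n`, `n + 1`, and a nondegenerate functional modulo `I` vanishes in degrees less than `n`, then `I`
has a nonzero element of degree at most `e`. -/
theorem exists_mem_totalDegreeLE {e : ℕ}
    (h₀ : Module.finrank k (leadingForms I (m + e)) = m + 1)
    (h₁ : Module.finrank k (leadingForms I (m + e + 1)) = m + 2)
    (hG : ∃ g ∈ leadingForms I (m + e), g.coeff (m + e) ≠ 0)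
    (Λ : k[X][X] →ₗ[k] k) (hΛI : ∀ u ∈ I, Λ u = 0)
    (hΛ : ∀ u : k[X][X], (radial u).natDegree < m + e → Λ u = 0)
    (hnd : ∀ u, (∀ g, Λ (g * u) = 0) → u ∈ I) :
    ∃ F ∈ I, F ≠ 0 ∧ F ∈ totalDegreeLE k e := by
  obtain ⟨f, hf, hV⟩ := exists_mul_degreeLT m (leadingForms I (m + e))
    (leadingForms I (m + e + 1)) h₀ h₁.le
    (by
      rintro p hp
      obtain ⟨u, hu, hd, rfl⟩ := mem_leadingForms.1 hp
      exact mem_leadingForms.2 ⟨C X * u, I.mul_mem_left _ hu, C_X_mul_mem hd,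
        topCoeff_succ_C_X_mul _ _⟩)
    (by
      rintro p hp
      obtain ⟨u, hu, hd, rfl⟩ := mem_leadingForms.1 hp
      exact mem_leadingForms.2 ⟨X * u, I.mul_mem_left _ hu, X_mul_mem hd,
        topCoeff_succ_X_mul _ _⟩)
  -- At most `e` because `f * X ^ m` has degree at most `m + e`; at least `e` because, by `hG`, some
  -- multiple `f * q` with `deg q ≤ m` has degree `m + e`.
  have hfe : f.natDegree = e := by
    refine le_antisymm ?_ ?_
    · have : f * X ^ m ∈ leadingForms I (m + e) := by
        rw [hV]
        exact ⟨X ^ m, by simp [mem_degreeLT]; norm_cast; omega, rfl⟩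
      obtain ⟨u, -, -, hu⟩ := mem_leadingForms.1 this
      have := natDegree_topCoeff_le (m + e) u
      rw [hu, natDegree_mul_X_pow _ hf] at this
      omega
    · obtain ⟨g, hg, hgc⟩ := hG
      rw [hV] at hg
      obtain ⟨q, hq, rfl⟩ := hg
      have h := le_natDegree_of_ne_zero hgc
      rw [LinearMap.mulLeft_apply] at h
      have h2 := natDegree_mul_le (p := f) (q := q)
      have h3 : q.natDegree ≤ m := by
        rw [SetLike.mem_coe, mem_degreeLT] at hq
        rw [natDegree_le_iff_coeff_eq_zero]
        rw [degree_lt_iff_coeff_zero] at hq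
        exact fun j hj => hq j hj
      omega
  set V : Submodule k k[X][X] := I.restrictScalars k ⊓ totalDegreeLE k (m + e) with hVdef
  -- The saturation of the ideal generated by `V` with respect to the nonzero polynomials in `x`.
  let H : Ideal k[X][X] :=
    { carrier := {u | ∃ p : k[X], p ≠ 0 ∧ C p * u ∈ prolongIdeal V}
      add_mem' := by
        rintro a b ⟨p, hp, hpa⟩ ⟨q, hq, hqb⟩
        refine ⟨p * q, mul_ne_zero hp hq, ?_⟩
        have : C (p * q) * (a + b) = C q * (C p * a) + C p * (C q * b) := by
          rw [map_mul]; ring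
        rw [this]
        exact add_mem (Ideal.mul_mem_left _ _ hpa) (Ideal.mul_mem_left _ _ hqb)
      zero_mem' := ⟨1, one_ne_zero, by simp⟩
      smul_mem' := by
        rintro g u ⟨p, hp, hpu⟩
        refine ⟨p, hp, ?_⟩
        rw [smul_eq_mul, mul_left_comm]
        exact Ideal.mul_mem_left _ _ hpu }
  have hH : ∀ u, u ∈ H ↔ ∃ p : k[X], p ≠ 0 ∧ C p * u ∈ prolongIdeal V := fun _ => Iff.rfl
  have hJH : ∀ r, ∀ u ∈ prolong V r, u ∈ H := fun r u hu =>
    (hH u).2 ⟨1, one_ne_zero, by simpa using mem_prolongIdeal.2 ⟨r, hu⟩⟩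
  have hdvd : ∀ u ∈ H, f ∣ (radial u).leadingCoeff := by
    rintro u ⟨p, hp, r, hr⟩
    have h := dvd_leadingCoeff_of_mem_prolong hV hf r hr
    rw [leadingCoeff_radial_C_mul] at h
    exact (IsUnit.dvd_mul_left (isUnit_C.2 (by simpa using hp))).1 h
  have hΛH : ∀ d, ∀ u ∈ H, (radial u).natDegree < m + e + d → Λ u = 0 := by
    intro d
    induction d with
    | zero => exact fun u _ hd => hΛ u hd
    | succ d ih =>
      intro u hu hd
      by_cases hlt : (radial u).natDegree < m + e + d
      · exact ih u hu hlt
      have ht : (radial u).natDegree = m + e + d := by omega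
      obtain ⟨q, hq⟩ := hdvd u hu
      have hu' : topCoeff (m + e + d) u = f * q := by rw [← hq, leadingCoeff, ht]; rfl
      have hqd : q ∈ degreeLT k (m + d + 1) := by
        rcases eq_or_ne q 0 with rfl | hq0
        · exact zero_mem _
        have := natDegree_topCoeff_le (m + e + d) u
        rw [hu', natDegree_mul hf hq0] at this
        rw [mem_degreeLT]
        exact degree_le_natDegree.trans_lt (by norm_cast; omega)
      -- An element of `I` with the same leading form as `u`: subtracting it lowers the degree and
      -- keeps `Λ u`.
      obtain ⟨g, hg, hge⟩ := exists_mem_prolong_topCoeff_eq hV d hqd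
      have hgI := prolong_le _ hg
      have hsub : Λ u = Λ (u - g) := by rw [map_sub, hΛI g hgI.1, sub_zero]
      rw [hsub]
      have hmem : u - g ∈ totalDegreeLE k (m + e + d) := sub_mem ht.le hgI.2
      rcases lt_or_eq_of_le (mem_totalDegreeLE.1 hmem) with h | h
      · exact ih _ (H.sub_mem hu (hJH d g hg)) h
      · have h0 : (radial (u - g)).leadingCoeff = 0 := by
          rw [leadingCoeff, h, ← topCoeff_apply, map_sub, hu', hge, sub_self]
        rw [leadingCoeff_eq_zero, map_eq_zero_iff _ radial_injective] at h0
        rw [h0, map_zero]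
  have hHI : ∀ u ∈ H, u ∈ I := fun u hu =>
    hnd u fun g => hΛH _ _ (H.mul_mem_left g hu) (by omega : _ < m + e + ((radial (g * u)).natDegree + 1))
  have hg₀ : f ∈ leadingForms I (m + e) := by
    rw [hV]; exact ⟨1, by simp [mem_degreeLT]; norm_cast; omega, by simp⟩
  have hg₁ : f * X ^ m ∈ leadingForms I (m + e) := by
    rw [hV]; exact ⟨X ^ m, by simp [mem_degreeLT]; norm_cast; omega, rfl⟩
  -- The leading forms of `G₀` and `G₁` are `x ^ m` and `y ^ m` times the form of `f`. `G₀` shows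
  -- that the leading coefficient of `F` divides `f`; `G₁` has full `s`-degree, which turns this
  -- into a bound on the total degree of `F`.
  obtain ⟨G₀, hG₀I, hG₀d, hG₀⟩ := mem_leadingForms.1 hg₀
  obtain ⟨G₁, hG₁I, hG₁d, hG₁⟩ := mem_leadingForms.1 hg₁
  have hG₀0 : G₀ ≠ 0 := by rintro rfl; simp at hG₀; exact hf hG₀.symm
  obtain ⟨F, hFH, hF0, hF⟩ := exists_generator_of_saturated H
    ((Submodule.ne_bot_iff _).2 ⟨G₀, hJH 0 _ ⟨hG₀I, hG₀d⟩, hG₀0⟩)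
    (by
      rintro p u hp ⟨q, hq, h⟩
      exact ⟨q * p, mul_ne_zero hq hp, by rwa [map_mul, mul_assoc]⟩)
  have hlead : ∀ u : k[X][X], u ∈ totalDegreeLE k (m + e) → topCoeff (m + e) u ≠ 0 →
      (radial u).natDegree = m + e ∧ (radial u).leadingCoeff = topCoeff (m + e) u := by
    intro u hd h0
    have : (radial u).natDegree = m + e := le_antisymm hd (le_natDegree_of_ne_zero h0)
    exact ⟨this, by rw [leadingCoeff, this]; rfl⟩
  have hfX : f * X ^ m ≠ 0 := mul_ne_zero hf (pow_ne_zero _ X_ne_zero)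
  obtain ⟨hd₁, hl₁⟩ := hlead G₁ hG₁d (hG₁ ▸ hfX)
  refine ⟨F, hHI F hFH, hF0, ?_⟩
  obtain ⟨Q, hQ⟩ := hF G₁ (hJH 0 _ ⟨hG₁I, hG₁d⟩)
  obtain ⟨Q₀, hQ₀⟩ := hF G₀ (hJH 0 _ ⟨hG₀I, hG₀d⟩)
  obtain ⟨hd₀, hl₀⟩ := hlead G₀ hG₀d (hG₀ ▸ hf)
  rw [hG₁, hQ, map_mul, leadingCoeff_mul] at hl₁
  rw [hG₀, hQ₀, map_mul, leadingCoeff_mul] at hl₀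
  have hG₁0 : radial F * radial Q ≠ 0 := by
    rw [← map_mul, ← hQ]
    intro h
    rw [hQ, map_mul] at h
    rw [← leadingCoeff_mul, h, leadingCoeff_zero] at hl₁
    exact hfX hl₁.symm
  have hF0' := left_ne_zero_of_mul hG₁0
  have hQ0' := right_ne_zero_of_mul hG₁0
  have hlFQ := congrArg natDegree hl₁
  rw [natDegree_mul (leadingCoeff_ne_zero.2 hF0') (leadingCoeff_ne_zero.2 hQ0'),
    natDegree_mul_X_pow _ hf] at hlFQ
  have hlF : (radial F).leadingCoeff.natDegree ≤ f.natDegree :=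
    natDegree_le_of_dvd ⟨_, hl₀.symm⟩ hf
  have hlQ : (radial Q).leadingCoeff.natDegree ≤ (radial Q).natDegree :=
    natDegree_topCoeff_le _ _
  rw [hQ, map_mul, natDegree_mul hF0' hQ0'] at hd₁
  rw [mem_totalDegreeLE]
  omega

end Core

/-! ### Dimension counts for leading forms. -/

section Dimension

variable {k : Type*} [Field k]

lemma finrank_map_add_finrank_inf_ker {M N : Type*} [AddCommGroup M] [Module k M]
    [AddCommGroup N] [Module k N] (φ : M →ₗ[k] N) (W : Submodule k M) [FiniteDimensional k W] :
    Module.finrank k (W.map φ) + Module.finrank k (W ⊓ LinearMap.ker φ : Submodule k M) =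
      Module.finrank k W := by
  rw [← LinearMap.finrank_range_add_finrank_ker (φ.domRestrict W), LinearMap.range_domRestrict,
    LinearMap.ker_domRestrict]
  congr 1
  rw [← Submodule.map_comap_subtype]
  exact (Submodule.equivMapOfInjective _ W.injective_subtype _).finrank_eq.symm

lemma add_le_of_coeff_ne_zero {t a b : ℕ} {u : k[X][X]} (hu : u ∈ totalDegreeLE k t)
    (h : (u.coeff b).coeff a ≠ 0) : a + b ≤ t := by
  by_contra! hlt
  refine h ?_
  have h1 := coeff_coeff_radial u (a + b) b
  rw [← topCoeff_apply, topCoeff_eq_zero hu hlt] at h1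
  simpa using h1.symm

lemma X_pow_mul_C_X_pow_mem {a b t : ℕ} (h : a + b ≤ t) :
    (X ^ b * C X ^ a : k[X][X]) ∈ totalDegreeLE k t := by
  refine totalDegreeLE_mono h ?_
  rw [mem_totalDegreeLE]
  simp only [map_mul, map_pow, radial_X, radial_C_X]
  have : (C X * X : k[X][X]).natDegree ≤ 1 := (natDegree_C_mul_le _ _).trans natDegree_X_le
  refine natDegree_mul_le.trans ?_
  have h1 := natDegree_pow_le_of_le b this
  rw [natDegree_X_pow]
  omega

lemma totalDegreeLE_eq_span (t : ℕ) :
    totalDegreeLE k t =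
      Submodule.span k {u | ∃ a b, a + b ≤ t ∧ u = (X ^ b * C X ^ a : k[X][X])} := by
  refine le_antisymm (fun u hu => ?_) (Submodule.span_le.2 ?_)
  · rw [u.as_sum_support]
    refine Submodule.sum_mem _ fun b _ => ?_
    rw [(u.coeff b).as_sum_support, map_sum]
    refine Submodule.sum_mem _ fun a ha => ?_
    have : monomial b (monomial a ((u.coeff b).coeff a)) =
        (u.coeff b).coeff a • (X ^ b * C X ^ a : k[X][X]) := by
      rw [← C_mul_X_pow_eq_monomial, ← C_mul_X_pow_eq_monomial, Algebra.smul_def, map_mul,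
        map_pow, mul_comm (X ^ b), ← mul_assoc]
      rfl
    rw [this]
    exact Submodule.smul_mem _ _ (Submodule.subset_span
      ⟨a, b, add_le_of_coeff_ne_zero hu (by simpa using ha), rfl⟩)
  · rintro _ ⟨a, b, h, rfl⟩
    exact X_pow_mul_C_X_pow_mem h

instance (t : ℕ) : FiniteDimensional k (totalDegreeLE k t) := by
  rw [totalDegreeLE_eq_span]
  refine FiniteDimensional.span_of_finite k (Set.Finite.subset
    (Set.finite_range (fun p : Fin (t + 1) × Fin (t + 1) =>
      (X ^ (p.2 : ℕ) * C X ^ (p.1 : ℕ) : k[X][X]))) ?_)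
  rintro _ ⟨a, b, h, rfl⟩
  exact ⟨(⟨a, by omega⟩, ⟨b, by omega⟩), rfl⟩

instance (I : Ideal k[X][X]) (t : ℕ) :
    FiniteDimensional k (I.restrictScalars k ⊓ totalDegreeLE k t : Submodule k k[X][X]) :=
  Submodule.finiteDimensional_of_le inf_le_right

lemma map_topCoeff_totalDegreeLE (t : ℕ) :
    (totalDegreeLE k t).map (topCoeff t) = degreeLT k (t + 1) := by
  refine le_antisymm ?_ ?_
  · rintro _ ⟨u, -, rfl⟩
    rw [mem_degreeLT]
    exact degree_le_natDegree.trans_lt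
      (by exact_mod_cast Nat.lt_succ_of_le (natDegree_topCoeff_le t u))
  · intro p hp
    rw [p.as_sum_range_C_mul_X_pow]
    refine Submodule.sum_mem _ fun b hb => ?_
    have hb' : b ≤ t := by
      rcases eq_or_ne p 0 with rfl | h0
      · simp at hb; omega
      · rw [mem_degreeLT, degree_eq_natDegree h0] at hp
        norm_cast at hp
        rw [Finset.mem_range] at hb
        omega
    rw [← smul_eq_C_mul]
    refine Submodule.smul_mem _ _ ⟨X ^ b * C X ^ (t - b), X_pow_mul_C_X_pow_mem (by omega), ?_⟩
    rw [topCoeff_apply, map_mul, map_pow, map_pow, radial_X, radial_C_X, mul_pow, mul_assoc,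
      ← pow_add, Nat.add_sub_cancel' hb', ← C_pow, coeff_C_mul_X_pow, if_pos rfl]

lemma totalDegreeLE_inf_ker (t : ℕ) :
    totalDegreeLE k (t + 1) ⊓ LinearMap.ker (topCoeff (t + 1)) = totalDegreeLE k t := by
  ext u
  exact ⟨fun h => mem_totalDegreeLE_of_topCoeff_eq_zero h.1 h.2, fun h =>
    ⟨totalDegreeLE_mono (Nat.le_succ t) h, topCoeff_eq_zero h (Nat.lt_succ_self t)⟩⟩

lemma finrank_degreeLT (t : ℕ) : Module.finrank k (degreeLT k t) = t := by
  rw [(degreeLTEquiv k t).finrank_eq]; simp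

lemma finrank_totalDegreeLE_succ (t : ℕ) :
    Module.finrank k (totalDegreeLE k (t + 1)) =
      Module.finrank k (totalDegreeLE k t) + (t + 2) := by
  have := finrank_map_add_finrank_inf_ker (topCoeff (t + 1)) (totalDegreeLE k (t + 1))
  rw [totalDegreeLE_inf_ker, map_topCoeff_totalDegreeLE, finrank_degreeLT] at this
  omega

lemma finrank_totalDegreeLE_zero : Module.finrank k (totalDegreeLE k 0) = 1 := by
  have := finrank_map_add_finrank_inf_ker (topCoeff 0) (totalDegreeLE k 0)
  have h : totalDegreeLE k 0 ⊓ LinearMap.ker (topCoeff 0) = ⊥ := by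
    rw [eq_bot_iff]
    rintro u ⟨hu, h0⟩
    rw [SetLike.mem_coe, mem_totalDegreeLE, Nat.le_zero] at hu
    rw [Submodule.mem_bot, ← map_eq_zero_iff _ radial_injective, eq_C_of_natDegree_eq_zero hu,
      ← topCoeff_apply, (h0 : topCoeff 0 u = 0), C_0]
  rw [h, map_topCoeff_totalDegreeLE, finrank_degreeLT, finrank_bot] at this
  omega

lemma finrank_inf_succ (I : Ideal k[X][X]) (t : ℕ) :
    Module.finrank k (leadingForms I (t + 1)) +
      Module.finrank k (I.restrictScalars k ⊓ totalDegreeLE k t : Submodule k k[X][X]) =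
    Module.finrank k (I.restrictScalars k ⊓ totalDegreeLE k (t + 1) : Submodule k k[X][X]) := by
  rw [← finrank_map_add_finrank_inf_ker (topCoeff (t + 1))
    (I.restrictScalars k ⊓ totalDegreeLE k (t + 1)), inf_assoc, totalDegreeLE_inf_ker]
  rfl

variable {N : Type*} [CommRing N] [Algebra k N] (E : k[X][X] →ₐ[k] N)

lemma finrank_map_add (t : ℕ) :
    Module.finrank k ((totalDegreeLE k t).map E.toLinearMap) +
      Module.finrank k ((RingHom.ker E).restrictScalars k ⊓ totalDegreeLE k t :
        Submodule k k[X][X]) = Module.finrank k (totalDegreeLE k t) := by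
  rw [← finrank_map_add_finrank_inf_ker E.toLinearMap (totalDegreeLE k t), inf_comm]
  rfl

/-- The leading forms of degree `t + 1` of the kernel of `E` are complementary to the growth of the
image of `E` from degree `t` to degree `t + 1`. -/
lemma finrank_leadingForms (t : ℕ) :
    Module.finrank k ((totalDegreeLE k (t + 1)).map E.toLinearMap) +
      Module.finrank k (leadingForms (RingHom.ker E) (t + 1)) =
    Module.finrank k ((totalDegreeLE k t).map E.toLinearMap) + (t + 2) := by
  have h1 := finrank_map_add E t
  have h2 := finrank_map_add E (t + 1)
  have h3 := finrank_inf_succ (RingHom.ker E) t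
  have h4 := finrank_totalDegreeLE_succ (k := k) t
  omega

end Dimension

/-! ### Homogeneous forms under scaling and restriction to lines. -/

section Homogeneous

variable {k A σ : Type*} [Field k] [CommRing A] [Algebra k A]

lemma aeval_smul_of_isHomogeneous {p : MvPolynomial σ k} {t : ℕ} (hp : p.IsHomogeneous t)
    (c : A) (v : σ → A) :
    MvPolynomial.aeval (fun i => c * v i) p = c ^ t * MvPolynomial.aeval v p := by
  rw [MvPolynomial.aeval_def, MvPolynomial.aeval_def, MvPolynomial.eval₂_eq,
    MvPolynomial.eval₂_eq, Finset.mul_sum]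
  refine Finset.sum_congr rfl fun d hd => ?_
  have : d.sum (fun _ e => e) = t := by
    rw [← hp (MvPolynomial.mem_support_iff.1 hd), Finsupp.weight_apply]; simp
  rw [← this, Finsupp.sum, ← Finset.prod_pow_eq_pow_sum]
  simp only [mul_pow, Finset.prod_mul_distrib]
  ring

/-- Along the line `a + b X` the coefficient of `X ^ t` is the value at the point at infinity `b`.
-/
lemma natDegree_coeff_aeval {p : MvPolynomial σ k} {t : ℕ} (hp : p.IsHomogeneous t)
    (a b : σ → A) :
    (MvPolynomial.aeval (fun i => C (a i) + C (b i) * X : σ → A[X]) p).natDegree ≤ t ∧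
      (MvPolynomial.aeval (fun i => C (a i) + C (b i) * X : σ → A[X]) p).coeff t =
        MvPolynomial.aeval b p := by
  have key : ∀ (s : Finset σ) (d : σ → ℕ),
      (∏ i ∈ s, (C (a i) + C (b i) * X : A[X]) ^ d i).natDegree ≤ ∑ i ∈ s, d i ∧
      (∏ i ∈ s, (C (a i) + C (b i) * X : A[X]) ^ d i).coeff (∑ i ∈ s, d i) =
        ∏ i ∈ s, b i ^ d i := by
    classical
    intro s d
    induction s using Finset.induction with
    | empty => simp
    | insert i s hi ih =>
      rw [Finset.prod_insert hi, Finset.sum_insert hi, Finset.prod_insert hi]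
      have h1 : (C (a i) + C (b i) * X : A[X]).natDegree ≤ 1 := by
        rw [add_comm]; exact natDegree_linear_le
      have h2 := natDegree_pow_le_of_le (d i) h1
      rw [mul_one] at h2
      refine ⟨natDegree_mul_le_of_le h2 ih.1, ?_⟩
      rw [coeff_mul_add_eq_of_natDegree_le h2 ih.1, ih.2]
      have h3 := coeff_pow_of_natDegree_le (m := d i) h1
      rw [mul_one] at h3
      rw [h3]
      simp
  rw [MvPolynomial.aeval_def, MvPolynomial.aeval_def, MvPolynomial.eval₂_eq,
    MvPolynomial.eval₂_eq]
  have hdeg : ∀ d ∈ p.support, ∑ i ∈ d.support, d i = t := by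
    intro d hd
    rw [← hp (MvPolynomial.mem_support_iff.1 hd), Finsupp.weight_apply]; simp [Finsupp.sum]
  constructor
  · refine natDegree_sum_le_of_forall_le _ _ fun d hd => ?_
    rw [IsScalarTower.algebraMap_apply k A A[X], algebraMap_eq]
    refine (natDegree_C_mul_le _ _).trans ?_
    rw [← hdeg d hd]
    exact (key _ _).1
  · rw [finsetSum_coeff]
    refine Finset.sum_congr rfl fun d hd => ?_
    rw [IsScalarTower.algebraMap_apply k A A[X], algebraMap_eq, coeff_C_mul, ← hdeg d hd,
      (key _ _).2]

end Homogeneous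

/-! ### From two decompositions of one form to a relation between point evaluations. -/

section Apolarity

variable {n : ℕ}

lemma coeff_linearForm_pow (a : Fin (n + 1) → ℂ) (d : ℕ) (α : Fin (n + 1) →₀ ℕ)
    (hα : ∑ i, α i = d) :
    (linearForm a ^ d).coeff α =
      (Nat.multinomial Finset.univ α : ℂ) * ∏ i, a i ^ α i := by
  rw [linearForm, Finset.sum_pow_eq_sum_piAntidiag, MvPolynomial.coeff_sum,
    Finset.sum_eq_single (α : Fin (n + 1) → ℕ)]
  · have : (∏ i, (MvPolynomial.C (a i) * MvPolynomial.X i) ^ α i :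
        MvPolynomial (Fin (n + 1)) ℂ) = MvPolynomial.monomial α (∏ i, a i ^ α i) := by
      rw [MvPolynomial.monomial_eq, Finsupp.prod_fintype _ _ (by simp), map_prod,
        ← Finset.prod_mul_distrib]
      simp [mul_pow]
    rw [this, ← map_natCast (MvPolynomial.C (R := ℂ) (σ := Fin (n + 1))), MvPolynomial.coeff_C_mul,
      MvPolynomial.coeff_monomial, if_pos rfl]
  · intro κ _ hκ
    have : (∏ i, (MvPolynomial.C (a i) * MvPolynomial.X i) ^ κ i :
        MvPolynomial (Fin (n + 1)) ℂ) =
        MvPolynomial.monomial (Finsupp.equivFunOnFinite.symm κ) (∏ i, a i ^ κ i) := by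
      rw [MvPolynomial.monomial_eq, Finsupp.prod_fintype _ _ (by simp), map_prod,
        ← Finset.prod_mul_distrib]
      simp [mul_pow]
    rw [this, ← map_natCast (MvPolynomial.C (R := ℂ) (σ := Fin (n + 1))), MvPolynomial.coeff_C_mul,
      MvPolynomial.coeff_monomial, if_neg, mul_zero]
    rintro rfl
    exact hκ rfl
  · intro h
    exact absurd (Finset.mem_piAntidiag.2 ⟨hα, by simp⟩) h

/-- A linear relation between the `d`-th powers of linear forms is a relation between the values of
the forms of degree `d` at the corresponding points. -/
lemma sum_mul_aeval_eq_zero {ι : Type*} (Z : Finset ι) (p : ι → Fin (n + 1) → ℂ) (c : ι → ℂ)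
    (d : ℕ) (h : ∑ P ∈ Z, c P • linearForm (p P) ^ d = 0)
    {G : MvPolynomial (Fin (n + 1)) ℂ} (hG : G.IsHomogeneous d) :
    ∑ P ∈ Z, c P * MvPolynomial.aeval (p P) G = 0 := by
  simp only [MvPolynomial.aeval_def, MvPolynomial.eval₂_eq', Finset.mul_sum]
  rw [Finset.sum_comm]
  refine Finset.sum_eq_zero fun α hα => ?_
  have hdeg : ∑ i, α i = d := by
    rw [← hG (MvPolynomial.mem_support_iff.1 hα), Finsupp.weight_apply,
      Finsupp.sum_fintype _ _ (by simp)]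
    simp
  have h1 := congrArg (MvPolynomial.coeff α) h
  simp only [MvPolynomial.coeff_sum, MvPolynomial.coeff_smul, coeff_linearForm_pow _ _ _ hdeg,
    MvPolynomial.coeff_zero, smul_eq_mul] at h1
  have h2 : (Nat.multinomial Finset.univ α : ℂ) * ∑ P ∈ Z, c P * ∏ i, p P i ^ α i = 0 := by
    rw [← h1, Finset.mul_sum]
    exact Finset.sum_congr rfl fun _ _ => by ring
  -- Characteristic zero: the multinomial weights can be cancelled.
  have h3 : (Nat.multinomial Finset.univ α : ℂ) ≠ 0 := by
    exact_mod_cast (Nat.multinomial_pos _ _).ne'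
  have h4 := (mul_eq_zero.1 h2).resolve_left h3
  calc ∑ P ∈ Z, c P * ((algebraMap ℂ ℂ) (G.coeff α) * ∏ i, p P i ^ α i)
      = (algebraMap ℂ ℂ) (G.coeff α) * ∑ P ∈ Z, c P * ∏ i, p P i ^ α i := by
        rw [Finset.mul_sum]; exact Finset.sum_congr rfl fun _ _ => by ring
    _ = 0 := by rw [h4, mul_zero]

lemma NonRedundant.exists_coeff {d : ℕ} {A : Finset (ℙ ℂ (Fin (n + 1) → ℂ))}
    {T : MvPolynomial (Fin (n + 1)) ℂ} (hA : NonRedundant d A T) :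
    ∃ c : ℙ ℂ (Fin (n + 1) → ℂ) → ℂ, (∀ P ∈ A, c P ≠ 0) ∧
      ∑ P ∈ A, c P • linearForm P.rep ^ d = T := by
  classical
  obtain ⟨c, hc⟩ := (Submodule.mem_span_image_finset_iff_exists_fun ℂ).1 hA.1
  refine ⟨fun P => if h : P ∈ A then c ⟨P, h⟩ else 0, ?_, ?_⟩
  -- A point with zero coefficient could be dropped, against non-redundancy.
  · intro P hP h0
    refine hA.2 (A.erase P) (Finset.erase_ssubset hP) ?_
    rw [Computes, ← hc]
    refine Submodule.sum_mem _ fun Q _ => ?_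
    by_cases hQ : (Q : ℙ ℂ (Fin (n + 1) → ℂ)) = P
    · subst hQ
      have : c Q = 0 := by simpa [hP] using h0
      rw [this, zero_smul]
      exact zero_mem _
    · exact Submodule.smul_mem _ _ (Submodule.subset_span
        ⟨Q, by simp [hQ], rfl⟩)
  · rw [← hc, ← Finset.sum_attach]
    refine Finset.sum_congr rfl fun P _ => ?_
    simp

/-- Two disjoint non-redundant sets computing the same form impose a relation with nonzero
coefficients on the values of the forms of degree `d`. -/
lemma NonRedundant.exists_relation [DecidableEq (ℙ ℂ (Fin (n + 1) → ℂ))] {d : ℕ}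
    {A B : Finset (ℙ ℂ (Fin (n + 1) → ℂ))} {T : MvPolynomial (Fin (n + 1)) ℂ}
    (hA : NonRedundant d A T) (hB : NonRedundant d B T) (hAB : A ∩ B = ∅) :
    ∃ c : ℙ ℂ (Fin (n + 1) → ℂ) → ℂ, (∀ P ∈ A ∪ B, c P ≠ 0) ∧
      ∀ G : MvPolynomial (Fin (n + 1)) ℂ, G.IsHomogeneous d →
        ∑ P ∈ A ∪ B, c P * MvPolynomial.aeval P.rep G = 0 := by
  obtain ⟨a, ha, haT⟩ := hA.exists_coeff
  obtain ⟨b, hb, hbT⟩ := hB.exists_coeff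
  have hdisj : Disjoint A B := Finset.disjoint_iff_inter_eq_empty.2 hAB
  refine ⟨fun P => if P ∈ A then a P else -b P, ?_, ?_⟩
  · intro P hP
    by_cases h : P ∈ A
    · simpa [h] using ha P h
    · simpa [h] using hb P ((Finset.mem_union.1 hP).resolve_left h)
  · intro G hG
    refine sum_mul_aeval_eq_zero _ _ _ d ?_ hG
    rw [Finset.sum_union hdisj]
    have h1 : ∑ P ∈ A, (if P ∈ A then a P else -b P) • linearForm P.rep ^ d = T := by
      rw [← haT]
      exact Finset.sum_congr rfl fun P hP => by rw [if_pos hP]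
    have h2 : ∑ P ∈ B, (if P ∈ A then a P else -b P) • linearForm P.rep ^ d = -T := by
      rw [← hbT, ← Finset.sum_neg_distrib]
      exact Finset.sum_congr rfl fun P hP => by
        rw [if_neg (Finset.disjoint_right.1 hdisj hP), neg_smul]
    rw [h1, h2, add_neg_cancel]

end Apolarity

/-! ### Affine charts and the Hilbert function of a finite set. -/

section Chart

variable (b : Module.Basis (Fin 3) ℂ (Fin 3 → ℂ))

/-- Evaluation of a bivariate polynomial at the affine coordinates of a point of the plane. -/
noncomputable def chart (v : Fin 3 → ℂ) : ℂ[X][X] →ₐ[ℂ] ℂ :=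
  aevalAeval (b.repr v 1 / b.repr v 0) (b.repr v 2 / b.repr v 0)

@[simp] lemma chart_X (v : Fin 3 → ℂ) : chart b v X = b.repr v 2 / b.repr v 0 := by
  simp [chart]

@[simp] lemma chart_C_X (v : Fin 3 → ℂ) : chart b v (C X) = b.repr v 1 / b.repr v 0 := by
  simp [chart]

lemma chart_C_C (v : Fin 3 → ℂ) (r : ℂ) : chart b v (C (C r)) = r :=
  (chart b v).commutes r

lemma exists_homogeneous_aeval_eq_coord (i : Fin 3) :
    ∃ L : MvPolynomial (Fin 3) ℂ, L.IsHomogeneous 1 ∧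
      ∀ v, MvPolynomial.aeval v L = b.repr v i := by
  refine ⟨linearForm (n := 2) (fun j => b.repr (Pi.single j 1) i), ?_, fun v => ?_⟩
  · refine MvPolynomial.IsHomogeneous.sum _ _ _ fun j _ => ?_
    simpa using (MvPolynomial.isHomogeneous_C (Fin 3) _).mul (MvPolynomial.isHomogeneous_X ℂ j)
  · have hv : v = ∑ j, v j • (Pi.single j 1 : Fin 3 → ℂ) := by
      ext j; simp [Finset.sum_apply, Pi.single_apply]
    conv_rhs => rw [hv]
    simp [linearForm, Finsupp.finsetSum_apply, mul_comm]

lemma exists_homogenization {t : ℕ} {u : ℂ[X][X]} (hu : u ∈ totalDegreeLE ℂ t) :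
    ∃ G : MvPolynomial (Fin 3) ℂ, G.IsHomogeneous t ∧ ∀ v, b.repr v 0 ≠ 0 →
      MvPolynomial.aeval v G = b.repr v 0 ^ t * chart b v u := by
  rw [totalDegreeLE_eq_span] at hu
  induction hu using Submodule.span_induction with
  | mem u hu =>
    obtain ⟨m, n, h, rfl⟩ := hu
    obtain ⟨L₀, h₀, e₀⟩ := exists_homogeneous_aeval_eq_coord b 0
    obtain ⟨L₁, h₁, e₁⟩ := exists_homogeneous_aeval_eq_coord b 1
    obtain ⟨L₂, h₂, e₂⟩ := exists_homogeneous_aeval_eq_coord b 2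
    obtain ⟨c, rfl⟩ := Nat.exists_eq_add_of_le h
    refine ⟨L₂ ^ n * L₁ ^ m * L₀ ^ c, ?_, fun v hv => ?_⟩
    · have := ((h₂.pow n).mul (h₁.pow m)).mul (h₀.pow c)
      rwa [one_mul, one_mul, one_mul, add_comm n m] at this
    · simp only [map_mul, map_pow, e₀, e₁, e₂, chart_X, chart_C_X, pow_add, div_pow]
      field_simp
  | zero => exact ⟨0, MvPolynomial.isHomogeneous_zero _ _ _, fun v _ => by simp⟩
  | add u w _ _ hu hw =>
    obtain ⟨G, hG, e⟩ := hu
    obtain ⟨G', hG', e'⟩ := hw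
    exact ⟨G + G', hG.add hG', fun v hv => by rw [map_add, map_add, e v hv, e' v hv, mul_add]⟩
  | smul r u _ hu =>
    obtain ⟨G, hG, e⟩ := hu
    refine ⟨r • G, ?_, fun v hv => ?_⟩
    · rw [MvPolynomial.smul_eq_C_mul]
      simpa using (MvPolynomial.isHomogeneous_C (Fin 3) r).mul hG
    · rw [map_smul, map_smul, e v hv, smul_eq_mul, smul_eq_mul]; ring

/-- `G` is restricted to `b 0 + x b 1 + y b 2`. The last clause detects whether the curve passes
through the point `b 2` at infinity. -/
lemma exists_dehomogenization {t : ℕ} {G : MvPolynomial (Fin 3) ℂ} (hG : G.IsHomogeneous t) :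
    ∃ u ∈ totalDegreeLE ℂ t, (∀ v, b.repr v 0 ≠ 0 →
      MvPolynomial.aeval v G = b.repr v 0 ^ t * chart b v u) ∧
      (topCoeff t u).coeff t = MvPolynomial.aeval (b 2) G := by
  set u : ℂ[X][X] := MvPolynomial.aeval
    (fun i => C (C (b 0 i)) + C X * C (C (b 1 i)) + X * C (C (b 2 i))) G with hu
  have hr : radial u = MvPolynomial.aeval
      (fun i => C (C (b 0 i)) + C (C (b 1 i) + C (b 2 i) * X) * X : Fin 3 → ℂ[X][X]) G := by
    rw [hu, MvPolynomial.comp_aeval_apply]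
    congr 2
    funext i
    simp only [map_add, map_mul, radial_X, radial_C, map_C, map_X]
    ring
  obtain ⟨h1, h2⟩ := natDegree_coeff_aeval hG (fun i => (C (b 0 i) : ℂ[X]))
    (fun i => C (b 1 i) + C (b 2 i) * X)
  refine ⟨u, ?_, fun v hv => ?_, ?_⟩
  · rw [mem_totalDegreeLE, hr]; exact h1
  · have hv' : v = fun i => b.repr v 0 * (b 0 i + b.repr v 1 / b.repr v 0 * b 1 i +
        b.repr v 2 / b.repr v 0 * b 2 i) := by
      funext i
      conv_lhs => rw [← b.sum_repr v]
      simp only [Fin.sum_univ_three, Pi.add_apply, Pi.smul_apply, smul_eq_mul]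
      field_simp
    conv_lhs => rw [hv']
    rw [aeval_smul_of_isHomogeneous hG, hu, MvPolynomial.comp_aeval_apply]
    congr 3
    funext i
    simp only [map_add, map_mul, chart_X, chart_C_X, chart_C_C]
  · rw [topCoeff_apply, hr, h2]
    exact (natDegree_coeff_aeval hG (b 1) (b 2)).2

/-- Evaluation of bivariate polynomials at the affine coordinates of the points of `Z`. -/
noncomputable def chartEval (Z : Finset (ℙ ℂ (Fin 3 → ℂ))) : ℂ[X][X] →ₐ[ℂ] (Z → ℂ) :=
  AlgHom.pi fun P => chart b P.1.rep

lemma mem_ker_chartEval {Z : Finset (ℙ ℂ (Fin 3 → ℂ))} {u : ℂ[X][X]} :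
    u ∈ RingHom.ker (chartEval b Z) ↔ ∀ P ∈ Z, chart b P.rep u = 0 := by
  rw [RingHom.mem_ker, funext_iff]
  exact ⟨fun h P hP => h ⟨P, hP⟩, fun h P => h P.1 P.2⟩

/-- Homogeneous and affine values differ at each point by a nonzero scalar, and a diagonal
automorphism preserves rank. -/
lemma hilbertFunction_eq_finrank {Z : Finset (ℙ ℂ (Fin 3 → ℂ))}
    (hZ : ∀ P ∈ Z, b.repr P.rep 0 ≠ 0) (t : ℕ) :
    hilbertFunction (n := 2) Z t =
      Module.finrank ℂ ((totalDegreeLE ℂ t).map (chartEval b Z).toLinearMap) := by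
  let D : (Z → ℂ) ≃ₗ[ℂ] (Z → ℂ) := LinearEquiv.piCongrRight fun P =>
    LinearEquiv.smulOfNeZero ℂ ℂ (b.repr P.1.rep 0 ^ t) (pow_ne_zero _ (hZ P.1 P.2))
  rw [hilbertFunction, if_neg (by omega), Int.toNat_natCast]
  suffices (LinearMap.range (evalMap Z t)) =
      ((totalDegreeLE ℂ t).map (chartEval b Z).toLinearMap).map (D : (Z → ℂ) →ₗ[ℂ] (Z → ℂ)) by
    rw [this, D.finrank_map_eq]
  refine le_antisymm ?_ ?_
  · rintro _ ⟨G, rfl⟩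
    obtain ⟨u, hu, h, -⟩ := exists_dehomogenization b
      ((MvPolynomial.mem_homogeneousSubmodule _ _).1 G.2)
    refine ⟨_, ⟨u, hu, rfl⟩, ?_⟩
    funext P
    exact (h _ (hZ P.1 P.2)).symm
  · rintro _ ⟨_, ⟨u, hu, rfl⟩, rfl⟩
    obtain ⟨G, hG, h⟩ := exists_homogenization b hu
    refine ⟨⟨G, (MvPolynomial.mem_homogeneousSubmodule _ _).2 hG⟩, ?_⟩
    funext P
    exact h _ (hZ P.1 P.2)

lemma Dh_zero_eq {Z : Finset (ℙ ℂ (Fin 3 → ℂ))} (hZ : ∀ P ∈ Z, b.repr P.rep 0 ≠ 0) :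
    Dh (n := 2) Z 0 + Module.finrank ℂ ((RingHom.ker (chartEval b Z)).restrictScalars ℂ ⊓
      totalDegreeLE ℂ 0 : Submodule ℂ ℂ[X][X]) = 1 := by
  have h := finrank_map_add (chartEval b Z) 0
  rw [finrank_totalDegreeLE_zero] at h
  have h0 := hilbertFunction_eq_finrank b hZ 0
  rw [Nat.cast_zero] at h0
  have h1 : hilbertFunction (n := 2) Z (0 - 1) = 0 := if_pos (by norm_num)
  rw [Dh, h0, h1]
  omega

lemma Dh_succ_eq {Z : Finset (ℙ ℂ (Fin 3 → ℂ))} (hZ : ∀ P ∈ Z, b.repr P.rep 0 ≠ 0) (t : ℕ) :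
    Dh (n := 2) Z (t + 1) + Module.finrank ℂ (leadingForms (RingHom.ker (chartEval b Z)) (t + 1)) =
      t + 2 := by
  have h := finrank_leadingForms (chartEval b Z) t
  have h0 := hilbertFunction_eq_finrank b hZ t
  have h1 := hilbertFunction_eq_finrank b hZ (t + 1)
  rw [Dh, add_sub_cancel_right, h0]
  rw [Nat.cast_succ] at h1
  rw [h1]
  omega

lemma Dh_succ_nonneg {Z : Finset (ℙ ℂ (Fin 3 → ℂ))} (hZ : ∀ P ∈ Z, b.repr P.rep 0 ≠ 0) (t : ℕ) :
    0 ≤ Dh (n := 2) Z (t + 1) := by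
  have h := Dh_succ_eq b hZ t
  have h2 := Submodule.finrank_mono (leadingForms_le (RingHom.ker (chartEval b Z)) (t + 1))
  rw [finrank_degreeLT] at h2
  omega

/-- A maximal difference leaves no leading form in that degree; hence no curve of degree at most `t`
contains `Z`. -/
lemma inf_totalDegreeLE_eq_bot {Z : Finset (ℙ ℂ (Fin 3 → ℂ))}
    (hZ : ∀ P ∈ Z, b.repr P.rep 0 ≠ 0) (t : ℕ) (h : ∀ j : ℕ, j ≤ t → Dh (n := 2) Z j = j + 1) :
    (RingHom.ker (chartEval b Z)).restrictScalars ℂ ⊓ totalDegreeLE ℂ t = ⊥ := by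
  rw [← Submodule.finrank_eq_zero]
  induction t with
  | zero =>
    have h0 := h 0 le_rfl
    have h1 := Dh_zero_eq b hZ
    push_cast at h0
    omega
  | succ t ih =>
    have h0 := h (t + 1) le_rfl
    have h1 := Dh_succ_eq b hZ t
    have h2 := ih fun j hj => h j (by omega)
    have h3 := finrank_inf_succ (RingHom.ker (chartEval b Z)) t
    push_cast at h0
    omega

/-- Points of the plane with the same affine coordinates are equal. -/
lemma eq_of_chart_eq {P Q : ℙ ℂ (Fin 3 → ℂ)} (hP : b.repr P.rep 0 ≠ 0) (hQ : b.repr Q.rep 0 ≠ 0)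
    (h₁ : chart b P.rep (C X) = chart b Q.rep (C X)) (h₂ : chart b P.rep X = chart b Q.rep X) :
    P = Q := by
  rw [chart_C_X, chart_C_X] at h₁
  rw [chart_X, chart_X] at h₂
  rw [← P.mk_rep, ← Q.mk_rep, Projectivization.mk_eq_mk_iff']
  refine ⟨b.repr P.rep 0 / b.repr Q.rep 0, ?_⟩
  apply b.repr.injective
  ext i
  rw [map_smul, Finsupp.smul_apply, smul_eq_mul]
  fin_cases i
  · simp only [Fin.zero_eta]; field_simp
  · simp only [Fin.mk_one]; field_simp at h₁ ⊢; linear_combination -h₁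
  · simp only [Fin.reduceFinMk]; field_simp at h₂ ⊢; linear_combination -h₂

lemma exists_interpolation {Z : Finset (ℙ ℂ (Fin 3 → ℂ))} (hZ : ∀ P ∈ Z, b.repr P.rep 0 ≠ 0)
    {P : ℙ ℂ (Fin 3 → ℂ)} (hP : P ∈ Z) :
    ∃ g : ℂ[X][X], chart b P.rep g ≠ 0 ∧ ∀ Q ∈ Z, Q ≠ P → chart b Q.rep g = 0 := by
  classical
  have h : ∀ Q ∈ Z, Q ≠ P → ∃ g : ℂ[X][X], chart b P.rep g ≠ 0 ∧ chart b Q.rep g = 0 := by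
    intro Q hQ hQP
    by_cases h1 : chart b P.rep (C X) = chart b Q.rep (C X)
    · refine ⟨X - C (C (chart b Q.rep X)), ?_, by rw [map_sub, chart_C_C, sub_self]⟩
      rw [map_sub, chart_C_C, sub_ne_zero]
      exact fun h2 => hQP (eq_of_chart_eq b (hZ P hP) (hZ Q hQ) h1 h2).symm
    · refine ⟨C X - C (C (chart b Q.rep (C X))), ?_, by rw [map_sub, chart_C_C, sub_self]⟩
      rw [map_sub, chart_C_C, sub_ne_zero]
      exact h1
  choose! g hg using h
  -- A product of lines, each through one other point and missing `P`.
  refine ⟨∏ Q ∈ Z.erase P, g Q, ?_, fun Q hQ hQP => ?_⟩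
  · rw [map_prod, Finset.prod_ne_zero_iff]
    intro Q hQ
    rw [Finset.mem_erase] at hQ
    exact (hg Q hQ.2 hQ.1).1
  · rw [map_prod]
    exact Finset.prod_eq_zero (Finset.mem_erase.2 ⟨hQP, hQ⟩) (hg Q hQ hQP).2

end Chart

/-! ### Choice of coordinates and the contradiction. -/

lemma exists_ne_zero_chart {u : ℂ[X][X]} (hu : u ≠ 0)
    (b : Module.Basis (Fin 3) ℂ (Fin 3 → ℂ)) :
    ∃ v, b.repr v 0 = 1 ∧ chart b v u ≠ 0 := by
  obtain ⟨y, hy⟩ : ∃ y : ℂ, u.eval (C y) ≠ 0 := by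
    by_contra! h
    exact hu (eq_zero_of_infinite_isRoot u ((Set.infinite_range_of_injective C_injective).mono
      (Set.range_subset_iff.2 h)))
  obtain ⟨x, hx⟩ : ∃ x : ℂ, (u.eval (C y)).eval x ≠ 0 := by
    by_contra! h
    exact hy (Polynomial.funext fun x => by rw [h x, eval_zero])
  refine ⟨b 0 + x • b 1 + y • b 2, by simp, ?_⟩
  rw [chart, coe_aevalAeval_eq_evalEval]
  simpa [evalEval] using hx

/-- Finitely many points outside `Q` are avoided by a line through `Q`. -/
lemma exists_dual_ne_zero {Z : Finset (ℙ ℂ (Fin 3 → ℂ))} (Q : Fin 3 → ℂ)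
    (hQ : ∀ P ∈ Z, P.rep ∉ Submodule.span ℂ {Q}) :
    ∃ z : Module.Dual ℂ (Fin 3 → ℂ), z Q = 0 ∧ ∀ P ∈ Z, z P.rep ≠ 0 := by
  obtain ⟨z, hz, h⟩ := Module.Dual.exists_forall_mem_ne_zero_of_forall_exists
    (Submodule.span ℂ {Q}).dualAnnihilator
    (fun P : Z => Module.Dual.eval ℂ (Fin 3 → ℂ) P.1.rep) (fun P => by
      obtain ⟨z, hz, hle⟩ := Submodule.exists_le_ker_of_notMem (hQ P.1 P.2)
      exact ⟨z, (Submodule.mem_dualAnnihilator z).2 fun w hw => hle hw, hz⟩)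
  exact ⟨z, (Submodule.mem_dualAnnihilator z).1 hz Q (Submodule.mem_span_singleton_self Q),
    fun P hP => h ⟨P, hP⟩⟩

/-- A basis adapted to a flag consisting of a line and a point on it. -/
lemma exists_basis_of_flag {z : Module.Dual ℂ (Fin 3 → ℂ)} (hz : z ≠ 0) {Q : Fin 3 → ℂ}
    (hQ : Q ≠ 0) (hzQ : z Q = 0) :
    ∃ b : Module.Basis (Fin 3) ℂ (Fin 3 → ℂ), b 2 = Q ∧ ∀ v, z v ≠ 0 → b.repr v 0 ≠ 0 := by
  have hker := Module.Dual.finrank_ker_add_one_of_ne_zero hz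
  rw [Module.finrank_fin_fun] at hker
  have hnle : ¬ LinearMap.ker z ≤ Submodule.span ℂ {Q} := fun h => by
    have := Submodule.finrank_mono h
    rw [finrank_span_singleton hQ] at this
    omega
  obtain ⟨w, hw, hwQ⟩ := SetLike.not_le_iff_exists.1 hnle
  obtain ⟨v₀, hv₀⟩ : ∃ v, z v ≠ 0 := by
    by_contra! h
    exact hz (LinearMap.ext h)
  have h1 : LinearIndependent ℂ ![Q] := by
    rw [linearIndependent_unique_iff]; exact hQ
  have h2 : LinearIndependent ℂ ![w, Q] :=
    linearIndependent_finCons.2 ⟨h1, by simpa using hwQ⟩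
  have h3 : LinearIndependent ℂ ![v₀, w, Q] := by
    refine linearIndependent_finCons.2 ⟨h2, fun h => hv₀ ?_⟩
    have : Submodule.span ℂ (Set.range ![w, Q]) ≤ LinearMap.ker z := by
      rw [Submodule.span_le]
      rintro _ ⟨i, rfl⟩
      fin_cases i
      · exact hw
      · exact hzQ
    exact this h
  refine ⟨basisOfLinearIndependentOfCardEqFinrank h3 (by simp), by simp, fun v hv h0 => hv ?_⟩
  set b := basisOfLinearIndependentOfCardEqFinrank h3 (by simp) with hb
  have hzw : z w = 0 := hw
  have hb1 : b 1 = w := by simp [hb]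
  have hb2 : b 2 = Q := by simp [hb]
  rw [← b.sum_repr v, Fin.sum_univ_three, h0, hb1, hb2]
  simp [hzw, hzQ]

lemma exists_basis_repr_ne_zero {Z : Finset (ℙ ℂ (Fin 3 → ℂ))} (hZ : Z.Nonempty) :
    ∃ b : Module.Basis (Fin 3) ℂ (Fin 3 → ℂ), ∀ P ∈ Z, b.repr P.rep 0 ≠ 0 := by
  obtain ⟨z, -, hz⟩ := exists_dual_ne_zero (Z := Z) 0 (fun P _ => by simpa using P.rep_nonzero)
  obtain ⟨P, hP⟩ := hZ
  have hz0 : z ≠ 0 := by rintro rfl; exact hz P hP rfl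
  have hker := Module.Dual.finrank_ker_add_one_of_ne_zero hz0
  rw [Module.finrank_fin_fun] at hker
  obtain ⟨Q, hQ, hQ0⟩ := Submodule.exists_mem_ne_zero_of_ne_bot
    (fun h : LinearMap.ker z = ⊥ => by rw [h, finrank_bot] at hker; omega)
  obtain ⟨b, -, hb⟩ := exists_basis_of_flag hz0 hQ0 hQ
  exact ⟨b, fun P hP => hb _ (hz P hP)⟩

lemma exists_basis_repr_ne_zero_of_notMem {Z : Finset (ℙ ℂ (Fin 3 → ℂ))} (hZ : Z.Nonempty)
    {Q : Fin 3 → ℂ} (hQ0 : Q ≠ 0) (hQ : ∀ P ∈ Z, P.rep ∉ Submodule.span ℂ {Q}) :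
    ∃ b : Module.Basis (Fin 3) ℂ (Fin 3 → ℂ), b 2 = Q ∧ ∀ P ∈ Z, b.repr P.rep 0 ≠ 0 := by
  obtain ⟨z, hzQ, hz⟩ := exists_dual_ne_zero Q hQ
  obtain ⟨P, hP⟩ := hZ
  have hz0 : z ≠ 0 := by rintro rfl; exact hz P hP rfl
  obtain ⟨b, hb2, hb⟩ := exists_basis_of_flag hz0 hQ0 hzQ
  exact ⟨b, hb2, fun P hP => hb _ (hz P hP)⟩

/-- A finite set satisfying the Cayley–Bacharach property in degree `d`, whose Hilbert function has
constant first difference `e` in degrees `m + e ≤ d + 1` and `m + e + 1`, lies on a curve of degree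
`e`; so the first difference is not maximal up to degree `e`. -/
theorem not_forall_Dh_eq_of_relation {Z : Finset (ℙ ℂ (Fin 3 → ℂ))} (hZne : Z.Nonempty)
    {d m e : ℕ} (hm : 0 < m) (hd : m + e ≤ d + 1) {c : ℙ ℂ (Fin 3 → ℂ) → ℂ}
    (hc : ∀ P ∈ Z, c P ≠ 0)
    (hrel : ∀ G : MvPolynomial (Fin 3) ℂ, G.IsHomogeneous d →
      ∑ P ∈ Z, c P * MvPolynomial.aeval P.rep G = 0)
    (h₀ : Dh (n := 2) Z ((m + e : ℕ) : ℤ) = e) (h₁ : Dh (n := 2) Z ((m + e : ℕ) + 1 : ℤ) = e) :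
    ¬ ∀ j : ℕ, j ≤ e → Dh (n := 2) Z j = j + 1 := by
  intro hfull
  obtain ⟨t, ht⟩ : ∃ t, m + e = t + 1 := ⟨m + e - 1, by omega⟩
  have hlead : ∀ b : Module.Basis (Fin 3) ℂ (Fin 3 → ℂ), (∀ P ∈ Z, b.repr P.rep 0 ≠ 0) →
      Module.finrank ℂ (leadingForms (RingHom.ker (chartEval b Z)) (m + e)) = m + 1 ∧
      Module.finrank ℂ (leadingForms (RingHom.ker (chartEval b Z)) (m + e + 1)) = m + 2 := by
    intro b hb
    have e1 := Dh_succ_eq b hb t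
    have e2 := Dh_succ_eq b hb (t + 1)
    rw [ht] at h₀ h₁ ⊢
    push_cast at h₀ h₁ e2
    rw [h₀] at e1
    rw [h₁] at e2
    omega
  -- An auxiliary chart yields a curve of degree `m + e` through `Z` and a point `Q` off it. The
  -- final chart has `b 2 = Q` at infinity, so that the leading form of `G` contains `y ^ (m + e)`.
  obtain ⟨Q, G, hG, hGZ, hGQ⟩ : ∃ (Q : Fin 3 → ℂ) (G : MvPolynomial (Fin 3) ℂ),
      G.IsHomogeneous (m + e) ∧ (∀ P ∈ Z, MvPolynomial.aeval P.rep G = 0) ∧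
      MvPolynomial.aeval Q G ≠ 0 := by
    obtain ⟨b, hb⟩ := exists_basis_repr_ne_zero hZne
    have hpos : leadingForms (RingHom.ker (chartEval b Z)) (m + e) ≠ ⊥ := fun h => by
      have := (hlead b hb).1
      rw [h, finrank_bot] at this
      omega
    obtain ⟨p, hp, hp0⟩ := Submodule.exists_mem_ne_zero_of_ne_bot hpos
    obtain ⟨u, hu, hut, rfl⟩ := mem_leadingForms.1 hp
    obtain ⟨Q, hQ, hQu⟩ := exists_ne_zero_chart
      (show u ≠ 0 by rintro rfl; exact hp0 (map_zero _)) b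
    obtain ⟨G, hG, hGe⟩ := exists_homogenization b hut
    refine ⟨Q, G, hG, fun P hP => ?_, ?_⟩
    · rw [hGe _ (hb P hP), (mem_ker_chartEval b).1 hu P hP, mul_zero]
    · rw [hGe _ (by rw [hQ]; exact one_ne_zero), hQ, one_pow, one_mul]
      exact hQu
  have haeval0 : MvPolynomial.aeval (0 : Fin 3 → ℂ) G = 0 := by
    have := aeval_smul_of_isHomogeneous hG (0 : ℂ) (0 : Fin 3 → ℂ)
    rw [zero_pow (by omega), zero_mul] at this
    simpa using this
  have hQ0 : Q ≠ 0 := by rintro rfl; exact hGQ haeval0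
  have hQZ : ∀ P ∈ Z, P.rep ∉ Submodule.span ℂ {Q} := by
    intro P hP hmem
    obtain ⟨r, hr⟩ := Submodule.mem_span_singleton.1 hmem
    have h1 := aeval_smul_of_isHomogeneous hG r Q
    have h2 : (fun i => r * Q i) = P.rep := by rw [← hr]; rfl
    rw [h2, hGZ P hP] at h1
    have h3 := (mul_eq_zero.1 h1.symm).resolve_right hGQ
    have h4 : r = 0 := pow_eq_zero_iff (by omega) |>.1 h3
    exact P.rep_nonzero (by rw [← hr, h4, zero_smul])
  obtain ⟨b, hb2, hb⟩ := exists_basis_repr_ne_zero_of_notMem hZne hQ0 hQZ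
  obtain ⟨l0, l1⟩ := hlead b hb
  -- The weights `b.repr P.rep 0 ^ d` make `Λ` agree with the relation on dehomogenized forms of
  -- degree `d`.
  let Λ : ℂ[X][X] →ₗ[ℂ] ℂ :=
    ∑ P ∈ Z, (c P * b.repr P.rep 0 ^ d) • (chart b P.rep).toLinearMap
  have hΛdef : ∀ u, Λ u = ∑ P ∈ Z, c P * b.repr P.rep 0 ^ d * chart b P.rep u := fun u => by
    simp [Λ, LinearMap.sum_apply]
  obtain ⟨F, hFI, hF0, hFd⟩ := exists_mem_totalDegreeLE l0 l1
    (by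
      obtain ⟨u, hu, hue, hut⟩ := exists_dehomogenization b hG
      refine ⟨_, mem_leadingForms.2 ⟨u, (mem_ker_chartEval b).2 fun P hP => ?_, hu, rfl⟩, ?_⟩
      · have := hue _ (hb P hP)
        rw [hGZ P hP] at this
        exact (mul_eq_zero.1 this.symm).resolve_left (pow_ne_zero _ (hb P hP))
      · rw [hut, hb2]; exact hGQ)
    Λ
    (fun u hu => by
      rw [hΛdef]
      exact Finset.sum_eq_zero fun P hP => by
        rw [(mem_ker_chartEval b).1 hu P hP, mul_zero])
    -- Degree below `m + e ≤ d + 1` means degree at most `d`, so the relation applies.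
    (fun u hu => by
      obtain ⟨G', hG', h'⟩ := exists_homogenization b
        (show u ∈ totalDegreeLE ℂ d from mem_totalDegreeLE.2 (by omega))
      rw [hΛdef, ← hrel G' hG']
      exact Finset.sum_congr rfl fun P hP => by rw [h' _ (hb P hP), mul_assoc])
    -- Testing against an interpolating `g` isolates the value of `u` at each point, since every
    -- coefficient is nonzero.
    (fun u hu => by
      refine (mem_ker_chartEval b).2 fun P hP => ?_
      obtain ⟨g, hg, hgZ⟩ := exists_interpolation b hb hP
      have h1 := hu g
      rw [hΛdef, Finset.sum_eq_single P (fun R hR hRP => by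
        rw [map_mul, hgZ R hR hRP, zero_mul, mul_zero]) (fun h => absurd hP h), map_mul] at h1
      have h2 : c P * b.repr P.rep 0 ^ d ≠ 0 := mul_ne_zero (hc P hP) (pow_ne_zero _ (hb P hP))
      exact (mul_eq_zero.1 ((mul_eq_zero.1 h1).resolve_left h2)).resolve_left hg)
  have hbot := inf_totalDegreeLE_eq_bot b hb e hfull
  have : F ∈ (RingHom.ker (chartEval b Z)).restrictScalars ℂ ⊓ totalDegreeLE ℂ e := ⟨hFI, hFd⟩
  rw [hbot] at this
  exact hF0 this

lemma Dh_empty (j : ℤ) : Dh (n := 2) ∅ j = 0 := by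
  have h : ∀ j, hilbertFunction (n := 2) ∅ j = 0 := fun j => by
    rw [hilbertFunction]
    split_ifs
    · rfl
    · exact Module.finrank_zero_of_subsingleton
  rw [Dh, h, h]; simp

lemma Dh_nonneg (Z : Finset (ℙ ℂ (Fin 3 → ℂ))) (j : ℤ) : 0 ≤ Dh (n := 2) Z j := by
  rcases Z.eq_empty_or_nonempty with rfl | hZ
  · rw [Dh_empty]
  obtain ⟨b, hb⟩ := exists_basis_repr_ne_zero hZ
  have hneg : ∀ j : ℤ, j < 0 → hilbertFunction (n := 2) Z j = 0 := fun j hj => if_pos hj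
  rcases le_or_gt j 0 with hj | hj
  · rw [Dh, hneg (j - 1) (by omega)]; simp
  · obtain ⟨t, rfl⟩ : ∃ t : ℕ, j = t + 1 := ⟨(j - 1).toNat, by omega⟩
    exact Dh_succ_nonneg b hb t

end Waring

theorem proposition2p12 [DecidableEq (ℙ ℂ (Fin 3 → ℂ))]
    (d : ℕ) (T : MvPolynomial (Fin 3) ℂ) (hT : T.IsHomogeneous d)
    (A : Finset (ℙ ℂ (Fin 3 → ℂ))) (hA : Waring.NonRedundant (n := 2) d A T) :
    ¬ ∃ B : Finset (ℙ ℂ (Fin 3 → ℂ)),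
      Waring.NonRedundant (n := 2) d B T ∧ A ∩ B = ∅ ∧ B.card ≤ A.card ∧
      ∃ i j₀ e : ℤ,
        ((∀ j : ℤ, 0 ≤ j → j ≤ i - 1 → Waring.Dh (n := 2) (A ∪ B) j = j + 1) ∧
          Waring.Dh (n := 2) (A ∪ B) i ≤ i) ∧
        (i - 1 < j₀ ∧ j₀ ≤ (d : ℤ) + 1 ∧
          Waring.Dh (n := 2) (A ∪ B) j₀ = e ∧ Waring.Dh (n := 2) (A ∪ B) (j₀ + 1) = e ∧
          e < i) := by
  rintro ⟨B, hB, hAB, -, i, j₀, e, ⟨hfull, -⟩, hij, hjd, h₀, h₁, hei⟩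
  have he : 0 ≤ e := h₀ ▸ Waring.Dh_nonneg _ _
  have hne : (A ∪ B).Nonempty := by
    by_contra h
    rw [Finset.not_nonempty_iff_eq_empty] at h
    have := hfull 0 le_rfl (by omega)
    rw [h, Waring.Dh_empty] at this
    omega
  obtain ⟨c, hc, hrel⟩ := hA.exists_relation hB hAB
  obtain ⟨e', rfl⟩ := Int.eq_ofNat_of_zero_le he
  -- Here `m = j₀ - e` is positive because `e < i ≤ j₀`.
  obtain ⟨m, rfl⟩ : ∃ m : ℕ, j₀ = ((m + e' : ℕ) : ℤ) :=
    ⟨(j₀ - e').toNat, by push_cast; omega⟩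
  refine Waring.not_forall_Dh_eq_of_relation hne (d := d) (m := m) (e := e') (by omega) (by omega)
    hc hrel h₀ h₁ fun j hj => hfull j (by omega) (by omega)
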